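/- **Setting.** Let $M$ and $\bar M$ be smooth $n$-dimensional manifolds (without boundary), topologically embedded in separable metrizable spaces in which their closures $\operatorname{cl} M$, $\operatorname{cl}\bar M$ are compact. Let $c:\operatorname{cl}(M\times\bar M)\to\mathbf R\cup\{+\infty\}$, let $N\subset M\times\bar M$ be open, and write $\bar N(x)=\{\bar x\in\bar M : (x,\bar x)\in N\}$ and $N(\bar x)=\{x\in M : (x,\bar x)\in N\}$. Suppose $c$ is finite and $C^4$ on $N$ and *non-degenerate*: the matrix $(c_{i\bar j})=(\partial^2 c/\partial x^{\bar j}\partial x^i)$ is invertible at each point of $N$. Then $$h=\frac12\begin{pmatrix}0&-\bar DDc\\-D\bar Dc&0\end{pmatrix},\qquad\text{i.e. } h(p\oplus\bar p,p\oplus\bar p)=-c_{i\bar j}\,p^ip^{\bar j},$$ is a pseudo-Riemannian metric on $N$. Geodesics are the affinely parametrized geodesics of its Levi-Civita connection, and $\sec_{(x,\bar x)}P\wedge Q=R_{i'j'k'l'}P^{i'}Q^{j'}P^{k'}Q^{l'}$ (unnormalized, with the sign for which round spheres are positively curved), where $R$ is its Riemann curvature tensor and the indices run over all $2n$ coordinates.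 **Definitions.** The cost $c$ is *weakly regular* on $N$ (A3w) if it is non-degenerate and $\sec_{(x,\bar x)}(p\oplus0)\wedge(0\oplus\bar p)\ge0$ for all $(x,\bar x)\in N$ and all null vectors $p\oplus\bar p\in T_{(x,\bar x)}N$, that is, $h(p\oplus\bar p,p\oplus\bar p)=0$. A set $W\subset\operatorname{cl}N$ is *geodesically convex* if any two distinct points of $W$ are joined by a continuous curve $[0,1]\to W$ which on $]0,1[$ is a geodesic lying in $N$ (its endpoints may lie on $\partial N$). A set $\bar\Omega\subset\operatorname{cl}\bar N(x)$ *appears convex from* $x\in M$ if $\{x\}\times\bar\Omega$ is geodesically convex. A set $\Omega\subset\operatorname{cl}N(\bar x)$ *appears convex from* $\bar x\in\bar M$ if $\Omega\times\{\bar x\}$ is geodesically convex. $N$ is *horizontally convex* if $N(\bar x)$ appears convex from $\bar x$ for every $\bar x\in\bar M$. For $\Omega\subset\operatorname{cl}M$, $u:\Omega\to\mathbf R\cup\{+\infty\}$ and $x\in\Omega$, the *$c$-contact set* $\partial^c_\Omega u(x)$ is the set of all $\bar x\in\operatorname{cl}\bar M$ such that $c(x,\bar x)<\infty$ and $u(y)+c(y,\bar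 x)\ge u(x)+c(x,\bar x)$ for all $y\in\Omega$. **Theorem 3.1** (Weak regularity connects $c$-contact sets). In this setting, suppose that $N$ is horizontally convex and that $c:\operatorname{cl}N\to\mathbf R\cup\{+\infty\}$ is continuous. Fix $\Omega\subset\operatorname{cl}M$, $x\in M$, and a set $\bar\Omega\subset\operatorname{cl}\bar N(x)$ which appears convex from $x$. Suppose that for each geodesic $t\in[0,1]\mapsto(x,\bar x(t))$ of $(N,h)$ with $\bar x(t)\in\bar\Omega$ for all $t\in[0,1]$, the set $\bigcap_{0\le t\le1}N(\bar x(t))$ is dense in $\Omega$, that is, $\Omega\subset\operatorname{cl}\bigcap_{0\le t\le1}N(\bar x(t))$. If $c$ is weakly regular on $N$, then for each $u:\Omega\to\mathbf R\cup\{+\infty\}$ with $x\in\Omega$ and $u(x)<\infty$, the set $\bar\Omega\cap\partial^c_\Omega u(x)$ is connected (possibly empty), and in fact appears convex from $x$. -/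

import Mathlib

open Set Topology
open scoped Manifold ContDiff

noncomputable section

namespace CostGeometry

/-! ### Pseudo-Riemannian geometry in coordinates

A coordinate patch of a product of two `n`-dimensional manifolds is an open subset of
`ℝⁿ × ℝⁿ`. The index `Sum.inl i` stands for the coordinate `xⁱ` on the first factor and
`Sum.inr j` for the (barred) coordinate on the second factor. -/

/-- The coordinate space `ℝⁿ × ℝⁿ`. -/
abbrev Coord (n : ℕ) : Type :=
  EuclideanSpace ℝ (Fin n) × EuclideanSpace ℝ (Fin n)

/-- The `2n` coordinate indices, unbarred ones and barred ones. -/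
abbrev Idx (n : ℕ) : Type := Fin n ⊕ Fin n

/-- The coordinate vectors of `ℝⁿ × ℝⁿ`. -/
def basisVec {n : ℕ} : Idx n → Coord n
  | Sum.inl i => (EuclideanSpace.single i 1, 0)
  | Sum.inr j => (0, EuclideanSpace.single j 1)

/-- The coordinate functions of `ℝⁿ × ℝⁿ`. -/
def coordFun {n : ℕ} : Idx n → Coord n → ℝ
  | Sum.inl i => fun z => z.1 i
  | Sum.inr j => fun z => z.2 j

/-- The partial derivative `∂F/∂xᴵ` at `z`. -/
def pd {n : ℕ} (I : Idx n) (F : Coord n → ℝ) (z : Coord n) : ℝ :=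
  fderiv ℝ F z (basisVec I)

/-- Christoffel symbols `Γ_{IJ}^A` of the Levi-Civita connection of the pseudo-metric `g`. -/
def christoffel {n : ℕ} (g : Coord n → Matrix (Idx n) (Idx n) ℝ) (A I J : Idx n)
    (z : Coord n) : ℝ :=
  (1 / 2) * ∑ K, (g z)⁻¹ A K *
    (pd I (fun w => g w K J) z + pd J (fun w => g w I K) z - pd K (fun w => g w I J) z)

/-- The components `R_{IJK}^A` of the Riemann curvature tensor of `g`. -/
def riemannUp {n : ℕ} (g : Coord n → Matrix (Idx n) (Idx n) ℝ) (I J K A : Idx n)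
    (z : Coord n) : ℝ :=
  -pd I (christoffel g A J K) z + pd J (christoffel g A I K) z
    + ∑ F, (christoffel g F K I z * christoffel g A J F z
        - christoffel g F K J z * christoffel g A I F z)

/-- The components `R_{IJKL}` of the Riemann curvature tensor of `g`, all indices lowered. -/
def riemann {n : ℕ} (g : Coord n → Matrix (Idx n) (Idx n) ℝ) (I J K L : Idx n)
    (z : Coord n) : ℝ :=
  ∑ A, g z L A * riemannUp g I J K A z

/-- The (unnormalized) sectional curvature `R_{IJKL} Pᴵ Qᴶ Pᴷ Qᴸ` of the plane `P ∧ Q`. -/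
def sec {n : ℕ} (g : Coord n → Matrix (Idx n) (Idx n) ℝ) (z : Coord n)
    (P Q : Idx n → ℝ) : ℝ :=
  ∑ I, ∑ J, ∑ K, ∑ L, riemann g I J K L z * P I * Q J * P K * Q L

/-! ### The pseudo-metric of a cost on a product of manifolds -/

section Manifolds

variable {n : ℕ} {M M' : Type*}
  [TopologicalSpace M] [ChartedSpace (EuclideanSpace ℝ (Fin n)) M]
  [TopologicalSpace M'] [ChartedSpace (EuclideanSpace ℝ (Fin n)) M']

/-- The preferred product coordinates around `p`, evaluated at `q`. -/
def toCoord (p q : M × M') : Coord n :=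
  (extChartAt (𝓡 n) p.1 q.1, extChartAt (𝓡 n) p.2 q.2)

/-- The function `f` on `M × M'`, expressed in the preferred product coordinates around `p`. -/
def inCoord (f : M × M' → ℝ) (p : M × M') (z : Coord n) : ℝ :=
  f ((extChartAt (𝓡 n) p.1).symm z.1, (extChartAt (𝓡 n) p.2).symm z.2)

/-- The matrix `∂²f/∂x^{j̄}∂xⁱ` of mixed partial derivatives, in coordinates around `p`. -/
def mixedHess (f : M × M' → ℝ) (p : M × M') (z : Coord n) : Matrix (Fin n) (Fin n) ℝ :=
  Matrix.of fun i j => pd (Sum.inr j) (pd (Sum.inl i) (inCoord f p)) z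

/-- The pseudo-metric `h` induced by the cost `f`, in coordinates around `p`: off-diagonal blocks
`-½ D̄Df` and `-½ DD̄f`. -/
def costMetric (f : M × M' → ℝ) (p : M × M') (z : Coord n) :
    Matrix (Idx n) (Idx n) ℝ :=
  Matrix.fromBlocks 0 (-(1 / 2 : ℝ) • mixedHess f p z)
    (-(1 / 2 : ℝ) • (mixedHess f p z).transpose) 0

/-- Non-degeneracy on `N`: the mixed second derivative, from the tangent space of the second factor
to the cotangent space of the first, is bijective at every point of `N`. -/
def Nondegenerate (n : ℕ) {M M' : Type*}
    [TopologicalSpace M] [ChartedSpace (EuclideanSpace ℝ (Fin n)) M]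
    [TopologicalSpace M'] [ChartedSpace (EuclideanSpace ℝ (Fin n)) M']
    (f : M × M' → ℝ) (N : Set (M × M')) : Prop :=
  ∀ p ∈ N, Function.Bijective (mixedHess (n := n) f p (toCoord p p)).mulVec

/-- `v = p ⊕ p̄` is a null vector of `h` at the point `a`. -/
def IsNull (f : M × M' → ℝ) (a : M × M') (v : Idx n → ℝ) : Prop :=
  ∑ I, ∑ J, costMetric f a (toCoord a a) I J * v I * v J = 0

/-- Weak regularity on `N`: the cost is non-degenerate, and `sec (p ⊕ 0) ∧ (0 ⊕ p̄) ≥ 0` for all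
null vectors `p ⊕ p̄` at points of `N`. -/
def WeaklyRegular (n : ℕ) {M M' : Type*}
    [TopologicalSpace M] [ChartedSpace (EuclideanSpace ℝ (Fin n)) M]
    [TopologicalSpace M'] [ChartedSpace (EuclideanSpace ℝ (Fin n)) M']
    (f : M × M' → ℝ) (N : Set (M × M')) : Prop :=
  Nondegenerate n f N ∧
  ∀ a ∈ N, ∀ p p' : Fin n → ℝ, IsNull f a (Sum.elim p p') →
    0 ≤ sec (costMetric f a) (toCoord a a) (Sum.elim p 0) (Sum.elim 0 p')

/-- `σ` satisfies the geodesic equation of `h` at time `t`, in the preferred coordinates around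
`σ t` (the equation is independent of the coordinates). -/
def GeodesicEqAt (n : ℕ) {M M' : Type*}
    [TopologicalSpace M] [ChartedSpace (EuclideanSpace ℝ (Fin n)) M]
    [TopologicalSpace M'] [ChartedSpace (EuclideanSpace ℝ (Fin n)) M']
    (f : M × M' → ℝ) (σ : ℝ → M × M') (t : ℝ) : Prop :=
  ∀ A : Idx n,
    deriv (deriv fun r => coordFun A (toCoord (n := n) (σ t) (σ r))) t
      + ∑ I, ∑ J, christoffel (costMetric f (σ t)) A I J (toCoord (σ t) (σ t))
          * deriv (fun r => coordFun I (toCoord (n := n) (σ t) (σ r))) t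
          * deriv (fun r => coordFun J (toCoord (n := n) (σ t) (σ r))) t = 0

/-- `σ` is an (affinely parametrized) geodesic of `(N, h)` on the open interval `]0,1[`. -/
def IsGeodesic (n : ℕ) {M M' : Type*}
    [TopologicalSpace M] [ChartedSpace (EuclideanSpace ℝ (Fin n)) M]
    [TopologicalSpace M'] [ChartedSpace (EuclideanSpace ℝ (Fin n)) M']
    (f : M × M' → ℝ) (N : Set (M × M')) (σ : ℝ → M × M') : Prop :=
  ContMDiffOn 𝓘(ℝ, ℝ) ((𝓡 n).prod (𝓡 n)) 2 σ (Ioo 0 1) ∧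
  ∀ t ∈ Ioo (0 : ℝ) 1, σ t ∈ N ∧ GeodesicEqAt n f σ t

end Manifolds

/-! ### Costs with values in `ℝ ∪ {+∞}`, convexity notions and contact sets

`ι : M → X` and `κ : M' → X'` are the embeddings of the manifolds in ambient spaces, where the
closures are taken. -/

section Ambient

variable {M M' X X' : Type*}

/-- The cost `c`, restricted to `M × M'` and read as a real-valued function where it is finite. -/
def realCost (ι : M → X) (κ : M' → X') (c : X × X' → WithTop ℝ) (p : M × M') : ℝ :=
  (c (ι p.1, κ p.2)).untopD 0

/-- The copy in `X × X'` of a subset `N` of `M × M'`. -/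
def embed (ι : M → X) (κ : M' → X') (N : Set (M × M')) : Set (X × X') :=
  Prod.map ι κ '' N

/-- `c ∈ C⁴(N)`: on `N` the cost is finite and four times continuously differentiable. -/
def IsC4On (n : ℕ)
    [TopologicalSpace M] [ChartedSpace (EuclideanSpace ℝ (Fin n)) M]
    [TopologicalSpace M'] [ChartedSpace (EuclideanSpace ℝ (Fin n)) M']
    (ι : M → X) (κ : M' → X') (c : X × X' → WithTop ℝ) (N : Set (M × M')) : Prop :=
  (∀ p ∈ N, c (ι p.1, κ p.2) ≠ ⊤) ∧
  ContMDiffOn ((𝓡 n).prod (𝓡 n)) 𝓘(ℝ, ℝ) 4 (realCost ι κ c) N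

/-- A geodesic segment of `(N, h)` whose endpoints are allowed to lie on the boundary of `N`: a
curve continuous on `[0,1]` which is a geodesic in `N` on `]0,1[`. (If an endpoint lies in `N`, the
geodesic equation extends to it by continuity.) -/
def IsGeodesicSegment (n : ℕ)
    [TopologicalSpace M] [ChartedSpace (EuclideanSpace ℝ (Fin n)) M]
    [TopologicalSpace M'] [ChartedSpace (EuclideanSpace ℝ (Fin n)) M']
    [TopologicalSpace X] [TopologicalSpace X']
    (ι : M → X) (κ : M' → X') (c : X × X' → WithTop ℝ) (N : Set (M × M'))
    (γ : ℝ → X × X') : Prop :=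
  ContinuousOn γ (Icc 0 1) ∧
  ∃ σ : ℝ → M × M', IsGeodesic n (realCost ι κ c) N σ ∧
    ∀ t ∈ Ioo (0 : ℝ) 1, γ t = Prod.map ι κ (σ t)

/-- Geodesic convexity of a subset `W` of the closure of `N`: any two points of `W` are linked by a
geodesic segment that stays in `W`. (A single point is linked to itself by the constant curve, also
when it lies on the boundary of `N`.) -/
def GeodesicallyConvex (n : ℕ)
    [TopologicalSpace M] [ChartedSpace (EuclideanSpace ℝ (Fin n)) M]
    [TopologicalSpace M'] [ChartedSpace (EuclideanSpace ℝ (Fin n)) M']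
    [TopologicalSpace X] [TopologicalSpace X']
    (ι : M → X) (κ : M' → X') (c : X × X' → WithTop ℝ) (N : Set (M × M'))
    (W : Set (X × X')) : Prop :=
  W ⊆ closure (embed ι κ N) ∧
  ∀ a ∈ W, ∀ b ∈ W, a ≠ b → ∃ γ : ℝ → X × X', IsGeodesicSegment n ι κ c N γ ∧
    γ 0 = a ∧ γ 1 = b ∧ ∀ t ∈ Icc (0 : ℝ) 1, γ t ∈ W

/-- The set `N̄(x)` of points of the second factor that are visible from `x`, as a subset
of `X'`. -/
def visibleFrom (κ : M' → X') (N : Set (M × M')) (x : M) : Set X' :=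
  κ '' {y | (x, y) ∈ N}

/-- The set `N(x̄)` of points of the first factor that are visible from `y = x̄`, as a subset
of `X`. -/
def visibleFrom' (ι : M → X) (N : Set (M × M')) (y : M') : Set X :=
  ι '' {x | (x, y) ∈ N}

/-- The subset `S` of the closure of the second factor appears convex from `x`. -/
def AppearsConvex (n : ℕ)
    [TopologicalSpace M] [ChartedSpace (EuclideanSpace ℝ (Fin n)) M]
    [TopologicalSpace M'] [ChartedSpace (EuclideanSpace ℝ (Fin n)) M']
    [TopologicalSpace X] [TopologicalSpace X']
    (ι : M → X) (κ : M' → X') (c : X × X' → WithTop ℝ) (N : Set (M × M'))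
    (x : M) (S : Set X') : Prop :=
  GeodesicallyConvex n ι κ c N ({ι x} ×ˢ S) ∧ S ⊆ closure (visibleFrom κ N x)

/-- The subset `S` of the closure of the first factor appears convex from the point `y` of the
second factor. -/
def AppearsConvex' (n : ℕ)
    [TopologicalSpace M] [ChartedSpace (EuclideanSpace ℝ (Fin n)) M]
    [TopologicalSpace M'] [ChartedSpace (EuclideanSpace ℝ (Fin n)) M']
    [TopologicalSpace X] [TopologicalSpace X']
    (ι : M → X) (κ : M' → X') (c : X × X' → WithTop ℝ) (N : Set (M × M'))
    (y : M') (S : Set X) : Prop :=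
  GeodesicallyConvex n ι κ c N (S ×ˢ {κ y}) ∧ S ⊆ closure (visibleFrom' ι N y)

/-- `N` is horizontally convex: `N(x̄)` appears convex from `x̄` for every `x̄`. -/
def HorizontallyConvex (n : ℕ)
    [TopologicalSpace M] [ChartedSpace (EuclideanSpace ℝ (Fin n)) M]
    [TopologicalSpace M'] [ChartedSpace (EuclideanSpace ℝ (Fin n)) M']
    [TopologicalSpace X] [TopologicalSpace X']
    (ι : M → X) (κ : M' → X') (c : X × X' → WithTop ℝ) (N : Set (M × M')) : Prop :=
  ∀ y : M', AppearsConvex' n ι κ c N y (visibleFrom' ι N y)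

/-- `Dom c`: the points of the closure of `M × M'` where the cost is finite. -/
def costDom [TopologicalSpace X] [TopologicalSpace X']
    (ι : M → X) (κ : M' → X') (c : X × X' → WithTop ℝ) : Set (X × X') :=
  {p | p ∈ closure (range ι ×ˢ range κ) ∧ c p < ⊤}

/-- The `c`-subdifferential of a function `u` on `Ω` (values of `u` off `Ω` play no role). -/
def cSubdifferential [TopologicalSpace X] [TopologicalSpace X']
    (ι : M → X) (κ : M' → X') (c : X × X' → WithTop ℝ) (Ω : Set X) (u : X → WithTop ℝ) :
    Set (X × X') :=
  {p | p.1 ∈ Ω ∧ p ∈ costDom ι κ c ∧ ∀ y ∈ Ω, u p.1 + c p ≤ u y + c (y, p.2)}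

/-- The `c`-contact set `∂ᶜ_Ω u(x)`. -/
def cContactSet [TopologicalSpace X] [TopologicalSpace X']
    (ι : M → X) (κ : M' → X') (c : X × X' → WithTop ℝ) (Ω : Set X) (u : X → WithTop ℝ)
    (x : X) : Set X' :=
  {y | y ∈ closure (range κ) ∧ (x, y) ∈ cSubdifferential ι κ c Ω u}

end Ambient

end CostGeometry

end

/-! Fix a competitor `y` and a geodesic `β` over `x` between two contact points. Contact at `b`
means c(y, b) - c(x, b) ≥ u(x) - u(y), so it suffices that k(t) = c(y, β t) - c(x, β t) never drops
below the smaller of its end values (Loeper's maximum principle; the double mountain stays above the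
sliding mountain).

Suppose k'(t₀) = 0 and join x to y by a horizontal geodesic `X` over β(t₀). Let e₁(s), e₂(s) be the
first and second time derivatives of c(X s, β t) at t₀. For an off-diagonal metric with a potential,
the differential D̄c is affine along horizontal geodesics. So e₁ is affine; its end values agree,
hence it is constant, which says that X'(s) ⊕ β'(t₀) is null. The curvature is exactly the remaining
fourth-order term: e₂'' = -2 sec ≤ 0 by weak regularity. Since `β` is itself a geodesic over X(0),
e₂' tends to 0 at s = 0. Therefore k''(t₀) = e₂(1) - e₂(0) ≤ 0
(`HorizontalGeodesic.second_variation`, `HorizontalGeodesic.tendsto_deriv_acc`,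
`HorizontalGeodesic.acc_le`).

A non-strict inequality at critical points alone does not exclude an interior minimum (t⁴ has one).
But it holds for all points near y and times near t₀, and by non-degeneracy k' can be brought to
zero by moving y a distance O(|k'|). This gives k'' ≤ C|k'| near t₀ (`le_mul_abs_of_zero_imp`,
`VerticalGeodesic.deriv_deriv_sub_le`). By a Gronwall argument k' ≤ 0 just after a minimum, so there
is no last interior minimum below the end values (`min_le_of_deriv_deriv_le`).

All this takes place inside N. Points y in the closure and endpoints of `β` on the boundary are
reached by density and continuity of c in `VerticalGeodesic.contact_inequality`. -/

noncomputable section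

namespace CostGeometry

/-! ### Partial derivatives in the coordinate space -/

section Coordinates

variable {n : ℕ}

/-- The coordinate functions as continuous linear maps. -/
def coordCLM (I : Idx n) : Coord n →L[ℝ] ℝ :=
  match I with
  | Sum.inl i => (EuclideanSpace.proj i).comp (ContinuousLinearMap.fst ℝ _ _)
  | Sum.inr j => (EuclideanSpace.proj j).comp (ContinuousLinearMap.snd ℝ _ _)

lemma coordCLM_apply (I : Idx n) (z : Coord n) : coordCLM I z = coordFun I z := by
  cases I <;> rfl

lemma sum_coordFun_smul_basisVec (v : Coord n) :
    ∑ I, coordFun I v • basisVec I = v := by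
  rw [Fintype.sum_sum_type]
  ext i
  · simp [coordFun, basisVec, Prod.fst_sum, Finset.sum_apply, Pi.single_apply]
  · simp [coordFun, basisVec, Prod.snd_sum, Finset.sum_apply, Pi.single_apply]

lemma fderiv_eq_sum_pd (F : Coord n → ℝ) (z v : Coord n) :
    fderiv ℝ F z v = ∑ I, pd I F z * coordFun I v := by
  conv_lhs => rw [← sum_coordFun_smul_basisVec v]
  simp [map_sum, pd, mul_comm]

lemma contDiffAt_pd {F : Coord n → ℝ} {z : Coord n} {k m : WithTop ℕ∞} (hF : ContDiffAt ℝ k F z)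
    (h : m + 1 ≤ k) (I : Idx n) : ContDiffAt ℝ m (pd I F) z :=
  (hF.fderiv_right h).clm_apply contDiffAt_const

lemma pd_comm {F : Coord n → ℝ} {z : Coord n} (hF : ContDiffAt ℝ 2 F z) (I J : Idx n) :
    pd I (pd J F) z = pd J (pd I F) z := by
  have hd : DifferentiableAt ℝ (fderiv ℝ F) z :=
    (hF.fderiv_right (m := 1) (by norm_num)).differentiableAt (by norm_num)
  have key : ∀ A B : Idx n, pd A (pd B F) z = fderiv ℝ (fderiv ℝ F) z (basisVec A) (basisVec B) := by
    intro A B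
    unfold pd
    rw [fderiv_clm_apply hd (differentiableAt_const _)]
    simp
  rw [key, key]
  exact (hF.isSymmSndFDerivAt (by simp)).eq _ _

lemma pd_congr {F G : Coord n → ℝ} {z : Coord n} (h : F =ᶠ[𝓝 z] G) (I : Idx n) :
    pd I F z = pd I G z := by
  unfold pd
  rw [h.fderiv_eq]

lemma hasDerivAt_comp_curve {F : Coord n → ℝ} {η : ℝ → Coord n} {η' : Coord n} {t : ℝ}
    (hF : DifferentiableAt ℝ F (η t)) (hη : HasDerivAt η η' t) :
    HasDerivAt (fun r => F (η r)) (∑ I, pd I F (η t) * coordFun I η') t := by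
  rw [← fderiv_eq_sum_pd]
  exact hF.hasFDerivAt.comp_hasDerivAt t hη

lemma hasDerivAt_coordFun {η : ℝ → Coord n} {η' : Coord n} {t : ℝ}
    (hη : HasDerivAt η η' t) (I : Idx n) :
    HasDerivAt (fun r => coordFun I (η r)) (coordFun I η') t := by
  simpa [coordCLM_apply, Function.comp_def] using (coordCLM I).hasFDerivAt.comp_hasDerivAt t hη

lemma deriv_comp_curve_eventuallyEq {F : Coord n → ℝ} {η : ℝ → Coord n} {t : ℝ}
    (hF : ContDiffAt ℝ 1 F (η t)) (hη : ContDiffAt ℝ 1 η t) :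
    deriv (fun r => F (η r)) =ᶠ[𝓝 t]
      fun r => ∑ I, pd I F (η r) * coordFun I (deriv η r) := by
  filter_upwards [hη.eventually (by simp),
    hη.continuousAt.eventually (hF.eventually (by simp))] with r h1 h2
  exact (hasDerivAt_comp_curve (h2.differentiableAt (by simp))
    (h1.differentiableAt (by simp)).hasDerivAt).deriv

lemma hasDerivAt_deriv {E : Type*} [NormedAddCommGroup E] [NormedSpace ℝ E] {η : ℝ → E} {t : ℝ}
    (hη : ContDiffAt ℝ 2 η t) : HasDerivAt (deriv η) (deriv (deriv η) t) t := by
  have h1 : ContDiffAt ℝ 1 (fderiv ℝ η) t := hη.fderiv_right (by norm_num)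
  have h2 : ContDiffAt ℝ 1 (fun r => fderiv ℝ η r 1) t := h1.clm_apply contDiffAt_const
  have h3 : (fun r => fderiv ℝ η r 1) = deriv η := by ext r; simp
  rw [h3] at h2
  exact (h2.differentiableAt (by simp)).hasDerivAt

lemma contDiffAt_deriv {E : Type*} [NormedAddCommGroup E] [NormedSpace ℝ E] {η : ℝ → E} {t : ℝ}
    {k m : WithTop ℕ∞} (hη : ContDiffAt ℝ k η t) (h : m + 1 ≤ k) : ContDiffAt ℝ m (deriv η) t := by
  have h1 : ContDiffAt ℝ m (fderiv ℝ η) t := hη.fderiv_right h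
  have h2 : ContDiffAt ℝ m (fun r => fderiv ℝ η r 1) t := h1.clm_apply contDiffAt_const
  have h3 : (fun r => fderiv ℝ η r 1) = deriv η := by ext r; simp
  rwa [h3] at h2

lemma hasDerivAt_deriv_comp_curve {F : Coord n → ℝ} {η : ℝ → Coord n} {t : ℝ}
    (hF : ContDiffAt ℝ 2 F (η t)) (hη : ContDiffAt ℝ 2 η t) :
    HasDerivAt (deriv fun r => F (η r))
      (∑ I, ((∑ J, pd J (pd I F) (η t) * coordFun J (deriv η t)) * coordFun I (deriv η t)
        + pd I F (η t) * coordFun I (deriv (deriv η) t))) t := by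
  refine HasDerivAt.congr_of_eventuallyEq ?_
    (deriv_comp_curve_eventuallyEq (hF.of_le (by norm_num)) (hη.of_le (by norm_num)))
  refine HasDerivAt.fun_sum fun I _ => ?_
  have hp : ContDiffAt ℝ 1 (pd I F) (η t) := contDiffAt_pd hF (by norm_num) I
  exact (hasDerivAt_comp_curve (hp.differentiableAt (by simp))
    (hη.differentiableAt (by simp)).hasDerivAt).mul (hasDerivAt_coordFun (hasDerivAt_deriv hη) I)

lemma deriv_coordFun_eventuallyEq {η : ℝ → Coord n} {t : ℝ} (hη : ContDiffAt ℝ 1 η t)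
    (I : Idx n) :
    deriv (fun r => coordFun I (η r)) =ᶠ[𝓝 t] fun r => coordFun I (deriv η r) := by
  filter_upwards [hη.eventually (by simp)] with r h1
  exact (hasDerivAt_coordFun (h1.differentiableAt (by simp)).hasDerivAt I).deriv

lemma deriv_deriv_coordFun {η : ℝ → Coord n} {t : ℝ} (hη : ContDiffAt ℝ 2 η t) (I : Idx n) :
    deriv (deriv fun r => coordFun I (η r)) t = coordFun I (deriv (deriv η) t) := by
  rw [(deriv_coordFun_eventuallyEq (hη.of_le (by norm_num)) I).deriv_eq]
  exact (hasDerivAt_coordFun (hasDerivAt_deriv hη) I).deriv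

end Coordinates

/-! ### The Levi-Civita connection and curvature of an off-diagonal metric -/

section OffDiagonal

variable {n : ℕ}

/-- The mixed second derivatives of a function on the coordinate space. -/
def mixedPd (φ : Coord n → ℝ) (z : Coord n) : Matrix (Fin n) (Fin n) ℝ :=
  Matrix.of fun i j => pd (Sum.inr j) (pd (Sum.inl i) φ) z

/-- The off-diagonal metric with potential `φ`. -/
def potentialMetric (φ : Coord n → ℝ) (z : Coord n) : Matrix (Idx n) (Idx n) ℝ :=
  Matrix.fromBlocks 0 (-(1 / 2 : ℝ) • mixedPd φ z) (-(1 / 2 : ℝ) • (mixedPd φ z).transpose) 0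

@[simp] lemma potentialMetric_inl_inl (φ : Coord n → ℝ) (z : Coord n) (i k : Fin n) :
    potentialMetric φ z (Sum.inl i) (Sum.inl k) = 0 := by simp [potentialMetric]

@[simp] lemma potentialMetric_inr_inr (φ : Coord n → ℝ) (z : Coord n) (i k : Fin n) :
    potentialMetric φ z (Sum.inr i) (Sum.inr k) = 0 := by simp [potentialMetric]

@[simp] lemma potentialMetric_inl_inr (φ : Coord n → ℝ) (z : Coord n) (i j : Fin n) :
    potentialMetric φ z (Sum.inl i) (Sum.inr j)
      = -(1 / 2) * pd (Sum.inr j) (pd (Sum.inl i) φ) z := by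
  simp [potentialMetric, mixedPd]

@[simp] lemma potentialMetric_inr_inl (φ : Coord n → ℝ) (z : Coord n) (i j : Fin n) :
    potentialMetric φ z (Sum.inr j) (Sum.inl i)
      = -(1 / 2) * pd (Sum.inr j) (pd (Sum.inl i) φ) z := by
  simp [potentialMetric, mixedPd]

lemma potentialMetric_isUnit {φ : Coord n → ℝ} {z : Coord n} (h : IsUnit (mixedPd φ z)) :
    IsUnit (potentialMetric φ z) := by
  set A := mixedPd φ z with hA
  have hd : IsUnit A.det := (Matrix.isUnit_iff_isUnit_det _).1 h
  have : potentialMetric φ z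
      * Matrix.fromBlocks 0 ((-2 : ℝ) • (A⁻¹).transpose) ((-2 : ℝ) • A⁻¹) 0 = 1 := by
    rw [potentialMetric, ← hA, Matrix.fromBlocks_multiply]
    simp [smul_smul, Matrix.mul_nonsing_inv _ hd,
      ← Matrix.transpose_mul, Matrix.nonsing_inv_mul _ hd]
  exact IsUnit.of_mul_eq_one _ this

lemma sum_metric_mul_christoffel {g : Coord n → Matrix (Idx n) (Idx n) ℝ} {z : Coord n}
    (h : IsUnit (g z)) (L I J : Idx n) :
    ∑ A, g z L A * christoffel g A I J z = (1 / 2) *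
      (pd I (fun w => g w L J) z + pd J (fun w => g w I L) z - pd L (fun w => g w I J) z) := by
  set D : Idx n → ℝ := fun K =>
    pd I (fun w => g w K J) z + pd J (fun w => g w I K) z - pd K (fun w => g w I J) z with hD
  have h1 : (fun A => christoffel g A I J z) = (1 / 2 : ℝ) • ((g z)⁻¹.mulVec D) := by
    ext A
    simp [christoffel, Matrix.mulVec, dotProduct, hD]
  have h2 : (g z).mulVec (fun A => christoffel g A I J z) = (1 / 2 : ℝ) • D := by
    rw [h1, Matrix.mulVec_smul, Matrix.mulVec_mulVec,
      Matrix.mul_nonsing_inv _ ((Matrix.isUnit_iff_isUnit_det _).1 h), Matrix.one_mulVec]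
  have h3 := congrFun h2 L
  simpa [Matrix.mulVec, dotProduct, hD] using h3

lemma pd_const_mul {F : Coord n → ℝ} {z : Coord n} (hF : DifferentiableAt ℝ F z) (a : ℝ)
    (I : Idx n) : pd I (fun w => a * F w) z = a * pd I F z := by
  unfold pd
  rw [fderiv_const_mul hF]
  simp

lemma pd_zero (z : Coord n) (I : Idx n) : pd I (fun _ => (0 : ℝ)) z = 0 := by
  simp [pd]

lemma pd_fun_sum {ι : Type*} {s : Finset ι} {F : ι → Coord n → ℝ} {z : Coord n}
    (hF : ∀ i ∈ s, DifferentiableAt ℝ (F i) z) (I : Idx n) :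
    pd I (fun w => ∑ i ∈ s, F i w) z = ∑ i ∈ s, pd I (F i) z := by
  unfold pd
  rw [fderiv_fun_sum hF]
  simp

lemma pd_mul {F G : Coord n → ℝ} {z : Coord n} (hF : DifferentiableAt ℝ F z)
    (hG : DifferentiableAt ℝ G z) (I : Idx n) :
    pd I (fun w => F w * G w) z = pd I F z * G z + F z * pd I G z := by
  unfold pd
  rw [fderiv_fun_mul hF hG]
  simp; ring

end OffDiagonal

/-! ### Entrywise smoothness of the inverse matrix, by the cofactor formula. -/

section MatrixInverse

variable {E : Type*} [NormedAddCommGroup E] [NormedSpace ℝ E] {ι : Type*} [Fintype ι]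
  [DecidableEq ι] {m : WithTop ℕ∞}

lemma contDiffAt_det {A : E → Matrix ι ι ℝ} {z : E}
    (hA : ∀ i j, ContDiffAt ℝ m (fun w => A w i j) z) :
    ContDiffAt ℝ m (fun w => (A w).det) z := by
  simp only [Matrix.det_apply, Units.smul_def, zsmul_eq_mul]
  exact ContDiffAt.sum fun σ _ => contDiffAt_const.mul (contDiffAt_prod fun i _ => hA _ _)

lemma contDiffAt_inv_apply {A : E → Matrix ι ι ℝ} {z : E}
    (hA : ∀ i j, ContDiffAt ℝ m (fun w => A w i j) z) (hz : IsUnit (A z)) (i j : ι) :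
    ContDiffAt ℝ m (fun w => (A w)⁻¹ i j) z := by
  have hd : (A z).det ≠ 0 := ((Matrix.isUnit_iff_isUnit_det _).1 hz).ne_zero
  simp only [Matrix.inv_def, Matrix.smul_apply, Ring.inverse_eq_inv', Matrix.adjugate_apply,
    smul_eq_mul]
  refine ((contDiffAt_det hA).inv hd).mul (contDiffAt_det fun k l => ?_)
  -- The adjugate entry is the determinant of `A w` with row `j` replaced by a constant unit vector.
  by_cases hk : k = j
  · subst hk
    simpa using contDiffAt_const
  · simpa [Matrix.updateRow_ne hk] using hA k l

lemma eventually_isUnit {A : E → Matrix ι ι ℝ} {z : E}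
    (hA : ∀ i j, ContDiffAt ℝ 0 (fun w => A w i j) z) (hz : IsUnit (A z)) :
    ∀ᶠ w in 𝓝 z, IsUnit (A w) := by
  have hd : (A z).det ≠ 0 := ((Matrix.isUnit_iff_isUnit_det _).1 hz).ne_zero
  filter_upwards [(contDiffAt_det hA).continuousAt.eventually_ne hd] with w hw
  exact (Matrix.isUnit_iff_isUnit_det _).2 (isUnit_iff_ne_zero.2 hw)

end MatrixInverse

/-! ### Christoffel symbols and mixed curvature of a metric with potential. -/

section OffDiagonal

variable {n : ℕ} {φ : Coord n → ℝ} {z : Coord n}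

lemma pd_comm_inner (hφ : ContDiffAt ℝ 3 φ z) (I J K : Idx n) :
    pd I (pd J (pd K φ)) z = pd I (pd K (pd J φ)) z := by
  refine pd_congr ?_ I
  filter_upwards [hφ.eventually (by simp)] with w hw
  exact pd_comm (hw.of_le (by norm_num)) J K

lemma pd_comm_outer (hφ : ContDiffAt ℝ 3 φ z) (I J K : Idx n) :
    pd I (pd J (pd K φ)) z = pd J (pd I (pd K φ)) z :=
  pd_comm (contDiffAt_pd hφ (by norm_num) K) I J

lemma contDiffAt_pd_pd {k m : WithTop ℕ∞} (hφ : ContDiffAt ℝ k φ z) (h : m + 2 ≤ k)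
    (I J : Idx n) : ContDiffAt ℝ m (pd I (pd J φ)) z := by
  have h' : (m + 1) + 1 ≤ k := by rwa [add_assoc, one_add_one_eq_two]
  exact contDiffAt_pd (contDiffAt_pd hφ h' J) le_rfl I

lemma contDiffAt_mixedPd {k m : WithTop ℕ∞} (hφ : ContDiffAt ℝ k φ z) (h : m + 2 ≤ k)
    (i j : Fin n) : ContDiffAt ℝ m (fun w => mixedPd φ w i j) z :=
  contDiffAt_pd_pd hφ h _ _

lemma contDiffAt_potentialMetric {k m : WithTop ℕ∞} (hφ : ContDiffAt ℝ k φ z) (h : m + 2 ≤ k)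
    (I J : Idx n) : ContDiffAt ℝ m (fun w => potentialMetric φ w I J) z := by
  rcases I with i | i <;> rcases J with j | j
  · simpa using contDiffAt_const
  · simpa only [potentialMetric_inl_inr, potentialMetric_inr_inl] using
      contDiffAt_const.mul (contDiffAt_pd_pd hφ h (Sum.inr j) (Sum.inl i))
  · simpa only [potentialMetric_inl_inr, potentialMetric_inr_inl] using
      contDiffAt_const.mul (contDiffAt_pd_pd hφ h (Sum.inr i) (Sum.inl j))
  · simpa using contDiffAt_const

lemma contDiffAt_christoffel (hφ : ContDiffAt ℝ 4 φ z) (hz : IsUnit (mixedPd φ z))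
    (A I J : Idx n) : ContDiffAt ℝ 1 (christoffel (potentialMetric φ) A I J) z := by
  have hg : ∀ K L, ContDiffAt ℝ 2 (fun w => potentialMetric φ w K L) z :=
    contDiffAt_potentialMetric hφ (by norm_num)
  unfold christoffel
  refine contDiffAt_const.mul (ContDiffAt.sum fun K _ => ?_)
  refine (contDiffAt_inv_apply (fun i j => (hg i j).of_le (by norm_num))
    (potentialMetric_isUnit hz) A K).mul ((contDiffAt_pd (hg _ _) (by norm_num) _).add
    (contDiffAt_pd (hg _ _) (by norm_num) _) |>.sub (contDiffAt_pd (hg _ _) (by norm_num) _))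

lemma pd_potentialMetric_inr_inl (hφ : ContDiffAt ℝ 3 φ z) (I : Idx n) (l k : Fin n) :
    pd I (fun w => potentialMetric φ w (Sum.inr l) (Sum.inl k)) z
      = -(1 / 2) * pd I (pd (Sum.inr l) (pd (Sum.inl k) φ)) z := by
  simp only [potentialMetric_inr_inl]
  exact pd_const_mul ((contDiffAt_pd_pd hφ (m := 1) (by norm_num) _ _).differentiableAt
    (by simp)) _ _

lemma pd_potentialMetric_inl_inr (hφ : ContDiffAt ℝ 3 φ z) (I : Idx n) (l k : Fin n) :
    pd I (fun w => potentialMetric φ w (Sum.inl k) (Sum.inr l)) z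
      = -(1 / 2) * pd I (pd (Sum.inr l) (pd (Sum.inl k) φ)) z := by
  simp only [potentialMetric_inl_inr]
  exact pd_const_mul ((contDiffAt_pd_pd hφ (m := 1) (by norm_num) _ _).differentiableAt
    (by simp)) _ _

/-- The lowered Christoffel symbols `Γ_{IJ, l̄}`. -/
lemma sum_mixedPd_mul_christoffel (hφ : ContDiffAt ℝ 3 φ z) (hz : IsUnit (mixedPd φ z))
    (l : Fin n) (I J : Idx n) :
    ∑ a, pd (Sum.inr l) (pd (Sum.inl a) φ) z * christoffel (potentialMetric φ) (Sum.inl a) I J z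
      = match I, J with
        | Sum.inl i, Sum.inl k => pd (Sum.inl i) (pd (Sum.inl k) (pd (Sum.inr l) φ)) z
        | _, _ => 0 := by
  have h := sum_metric_mul_christoffel (potentialMetric_isUnit hz) (Sum.inr l) I J
  rw [Fintype.sum_sum_type] at h
  simp only [potentialMetric_inr_inl, potentialMetric_inr_inr, zero_mul, Finset.sum_const_zero,
    add_zero, mul_assoc, ← Finset.mul_sum] at h
  -- For two unbarred indices the entry `g_{ik}` vanishes and the two other terms are equal third
  -- derivatives. For one barred index the two surviving terms cancel by symmetry of third
  -- derivatives. For two barred indices every entry involved is zero.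
  rcases I with i | i <;> rcases J with k | k <;>
  simp only [potentialMetric_inr_inr, potentialMetric_inl_inl, pd_zero,
    pd_potentialMetric_inr_inl hφ, pd_potentialMetric_inl_inr hφ] at h ⊢
  · rw [pd_comm_inner hφ (Sum.inl i) (Sum.inr l), pd_comm_inner hφ (Sum.inl k) (Sum.inr l),
      pd_comm_outer hφ (Sum.inl k) (Sum.inl i)] at h
    linarith
  · rw [pd_comm_outer hφ (Sum.inr k) (Sum.inr l)] at h
    linarith
  · rw [pd_comm_outer hφ (Sum.inr i) (Sum.inr l)] at h
    linarith
  · linarith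

/-- The lowered Christoffel symbols `Γ_{IJ, l}`. -/
lemma sum_mixedPd_mul_christoffel' (hφ : ContDiffAt ℝ 3 φ z) (hz : IsUnit (mixedPd φ z))
    (l : Fin n) (I J : Idx n) :
    ∑ a, pd (Sum.inr a) (pd (Sum.inl l) φ) z * christoffel (potentialMetric φ) (Sum.inr a) I J z
      = match I, J with
        | Sum.inr i, Sum.inr k => pd (Sum.inr i) (pd (Sum.inr k) (pd (Sum.inl l) φ)) z
        | _, _ => 0 := by
  have h := sum_metric_mul_christoffel (potentialMetric_isUnit hz) (Sum.inl l) I J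
  rw [Fintype.sum_sum_type] at h
  simp only [potentialMetric_inl_inr, potentialMetric_inl_inl, zero_mul, Finset.sum_const_zero,
    zero_add, mul_assoc, ← Finset.mul_sum] at h
  rcases I with i | i <;> rcases J with k | k <;>
  simp only [potentialMetric_inr_inr, potentialMetric_inl_inl, pd_zero,
    pd_potentialMetric_inr_inl hφ, pd_potentialMetric_inl_inr hφ] at h ⊢
  · linarith
  · rw [pd_comm_inner hφ (Sum.inl i) (Sum.inr k) (Sum.inl l),
      pd_comm_outer hφ (Sum.inl i) (Sum.inl l), pd_comm_inner hφ (Sum.inl l) (Sum.inl i)] at h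
    linarith
  · rw [pd_comm_inner hφ (Sum.inl k) (Sum.inr i) (Sum.inl l),
      pd_comm_outer hφ (Sum.inl k) (Sum.inl l), pd_comm_inner hφ (Sum.inl l) (Sum.inl k)] at h
    linarith
  · rw [pd_comm_outer hφ (Sum.inr k) (Sum.inr i)] at h
    linarith

/-- The lowered symbols vanish, and the mixed Hessian that lowers the index is invertible. -/
lemma christoffel_inl_eq_zero (hφ : ContDiffAt ℝ 3 φ z) (hz : IsUnit (mixedPd φ z))
    (a : Fin n) (I J : Idx n) (hIJ : I.isRight ∨ J.isRight) :
    christoffel (potentialMetric φ) (Sum.inl a) I J z = 0 := by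
  set x : Fin n → ℝ := fun a => christoffel (potentialMetric φ) (Sum.inl a) I J z with hx
  have h : Matrix.vecMul x (mixedPd φ z) = Matrix.vecMul 0 (mixedPd φ z) := by
    ext l
    have := sum_mixedPd_mul_christoffel hφ hz l I J
    simp only [Matrix.vecMul, dotProduct, mixedPd, Matrix.of_apply, Pi.zero_apply, zero_mul,
      Finset.sum_const_zero, hx]
    simp only [mul_comm (christoffel _ _ _ _ _)]
    rw [this]
    rcases I with i | i <;> rcases J with k | k <;> simp_all
  exact congrFun (Matrix.vecMul_injective_iff_isUnit.2 hz h) a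

lemma eventually_isUnit_mixedPd (hφ : ContDiffAt ℝ 2 φ z) (hz : IsUnit (mixedPd φ z)) :
    ∀ᶠ w in 𝓝 z, IsUnit (mixedPd φ w) :=
  eventually_isUnit (fun i j => contDiffAt_mixedPd hφ (by norm_num) i j) hz

/-- Symbols with unbarred upper index and a barred lower index vanish, which kills one factor in
each quadratic term. They vanish on a whole neighbourhood, so one of the two derivative terms
disappears as well. -/
lemma riemannUp_mixed (hφ : ContDiffAt ℝ 4 φ z) (hz : IsUnit (mixedPd φ z)) (i j k a : Fin n) :
    riemannUp (potentialMetric φ) (Sum.inl i) (Sum.inr j) (Sum.inl k) (Sum.inl a) z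
      = pd (Sum.inr j) (christoffel (potentialMetric φ) (Sum.inl a) (Sum.inl i) (Sum.inl k)) z := by
  have hφ3 : ContDiffAt ℝ 3 φ z := hφ.of_le (by norm_num)
  have h0 : christoffel (potentialMetric φ) (Sum.inl a) (Sum.inr j) (Sum.inl k)
      =ᶠ[𝓝 z] fun _ => 0 := by
    filter_upwards [hφ3.eventually (by simp),
      eventually_isUnit_mixedPd (hφ.of_le (by norm_num)) hz] with w h1 h2
    exact christoffel_inl_eq_zero h1 h2 a _ _ (by simp)
  have hz0 := christoffel_inl_eq_zero hφ3 hz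
  rw [riemannUp, pd_congr h0, pd_zero, Fintype.sum_sum_type]
  have e1 : ∀ F, christoffel (potentialMetric φ) (Sum.inl a) (Sum.inr j) F z = 0 :=
    fun F => hz0 a _ _ (by simp)
  have e2 : ∀ b, christoffel (potentialMetric φ) (Sum.inl b) (Sum.inl k) (Sum.inr j) z = 0 :=
    fun b => hz0 b _ _ (by simp)
  have e3 : ∀ b, christoffel (potentialMetric φ) (Sum.inl a) (Sum.inl i) (Sum.inr b) z = 0 :=
    fun b => hz0 a _ _ (by simp)
  simp [e1, e2, e3]

/-- Differentiate the identity `∑ₐ φ_{l̄a} Γ^a_{ik} = φ_{ikl̄}`, valid near `z`, in the direction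
`j̄`. The product rule expresses `∑ₐ φ_{l̄a} ∂_{j̄} Γ^a_{ik}`, which is the lowered curvature up to
the factor `-1/2`. -/
lemma riemann_mixed (hφ : ContDiffAt ℝ 4 φ z) (hz : IsUnit (mixedPd φ z)) (i j k l : Fin n) :
    riemann (potentialMetric φ) (Sum.inl i) (Sum.inr j) (Sum.inl k) (Sum.inr l) z
      = -(1 / 2) * (pd (Sum.inr j) (pd (Sum.inl i) (pd (Sum.inl k) (pd (Sum.inr l) φ))) z
        - ∑ a, pd (Sum.inr j) (pd (Sum.inr l) (pd (Sum.inl a) φ)) z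
          * christoffel (potentialMetric φ) (Sum.inl a) (Sum.inl i) (Sum.inl k) z) := by
  have hΓ : ∀ a, DifferentiableAt ℝ
      (christoffel (potentialMetric φ) (Sum.inl a) (Sum.inl i) (Sum.inl k)) z :=
    fun a => (contDiffAt_christoffel hφ hz _ _ _).differentiableAt (by simp)
  have hc : ∀ a, DifferentiableAt ℝ (pd (Sum.inr l) (pd (Sum.inl a) φ)) z :=
    fun a => (contDiffAt_pd_pd hφ (m := 1) (by norm_num) _ _).differentiableAt (by simp)
  have h0 : (fun w => ∑ a, pd (Sum.inr l) (pd (Sum.inl a) φ) w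
      * christoffel (potentialMetric φ) (Sum.inl a) (Sum.inl i) (Sum.inl k) w)
      =ᶠ[𝓝 z] pd (Sum.inl i) (pd (Sum.inl k) (pd (Sum.inr l) φ)) := by
    have hφ3 : ContDiffAt ℝ 3 φ z := hφ.of_le (by norm_num)
    filter_upwards [hφ3.eventually (by simp),
      eventually_isUnit_mixedPd (hφ.of_le (by norm_num)) hz] with w h1 h2
    exact sum_mixedPd_mul_christoffel h1 h2 l (Sum.inl i) (Sum.inl k)
  have h1 := pd_congr h0 (Sum.inr j)
  rw [pd_fun_sum (F := fun a w => pd (Sum.inr l) (pd (Sum.inl a) φ) w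
    * christoffel (potentialMetric φ) (Sum.inl a) (Sum.inl i) (Sum.inl k) w)
    (fun a _ => (hc a).mul (hΓ a))] at h1
  simp only [pd_mul (hc _) (hΓ _), Finset.sum_add_distrib] at h1
  rw [← h1, riemann, Fintype.sum_sum_type]
  simp only [riemannUp_mixed hφ hz, potentialMetric_inr_inl, potentialMetric_inr_inr, zero_mul,
    Finset.sum_const_zero, add_zero, mul_assoc, ← Finset.mul_sum]
  ring

lemma sec_mixed (g : Coord n → Matrix (Idx n) (Idx n) ℝ) (z : Coord n) (p v : Fin n → ℝ) :
    sec g z (Sum.elim p 0) (Sum.elim 0 v)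
      = ∑ i, ∑ j, ∑ k, ∑ l,
        riemann g (Sum.inl i) (Sum.inr j) (Sum.inl k) (Sum.inr l) z * p i * v j * p k * v l := by
  simp [sec, Fintype.sum_sum_type]

/-- Index bookkeeping for `GeodesicAt.deriv_deriv_hessInr`: `A`, `B`, `C` stand for fourth
derivatives, third derivatives and Christoffel symbols. The left side is `-2 sec`, the right side
comes from the chain rule along a geodesic. -/
lemma sum_quartic_rearrange (A : Fin n → Fin n → Fin n → Fin n → ℝ) (B C : Fin n → Fin n → Fin n → ℝ)
    (p v : Fin n → ℝ) :
    -2 * ∑ i, ∑ j, ∑ k, ∑ l,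
        -(1 / 2) * (A i j k l - ∑ a, B a j l * C a i k) * p i * v j * p k * v l
      = ∑ i, ((∑ k, (∑ j, ∑ l, A i j k l * v j * v l) * p k) * p i
        + (∑ j, ∑ l, B i j l * v j * v l) * -∑ j, ∑ k, C i j k * p j * p k) := by
  have e1 : ∑ i, ∑ j, ∑ k, ∑ l, A i j k l * p i * v j * p k * v l
      = ∑ i, (∑ k, (∑ j, ∑ l, A i j k l * v j * v l) * p k) * p i := by
    refine Finset.sum_congr rfl fun i _ => ?_
    simp only [Finset.sum_mul]
    rw [Finset.sum_comm]
    exact Finset.sum_congr rfl fun k _ => Finset.sum_congr rfl fun j _ =>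
      Finset.sum_congr rfl fun l _ => by ring
  have e2 : ∑ i, ∑ j, ∑ k, ∑ l, (∑ a, B a j l * C a i k) * p i * v j * p k * v l
      = ∑ a, (∑ j, ∑ l, B a j l * v j * v l) * ∑ i, ∑ k, C a i k * p i * p k := by
    have e3 : ∀ a, (∑ j, ∑ l, B a j l * v j * v l) * ∑ i, ∑ k, C a i k * p i * p k
        = ∑ i, ∑ j, ∑ k, ∑ l, B a j l * C a i k * p i * v j * p k * v l := by
      intro a
      rw [mul_comm, Finset.sum_mul_sum]
      refine Finset.sum_congr rfl fun i _ => Finset.sum_congr rfl fun j _ => ?_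
      rw [Finset.sum_mul_sum]
      exact Finset.sum_congr rfl fun k _ => Finset.sum_congr rfl fun l _ => by ring
    simp only [e3, Finset.sum_mul]
    rw [Finset.sum_comm (s := (Finset.univ : Finset (Fin n))) (t := Finset.univ)
      (f := fun a i => ∑ j, ∑ k, ∑ l, B a j l * C a i k * p i * v j * p k * v l)]
    refine Finset.sum_congr rfl fun i _ => ?_
    rw [Finset.sum_comm (f := fun a j => ∑ k, ∑ l, B a j l * C a i k * p i * v j * p k * v l)]
    refine Finset.sum_congr rfl fun j _ => ?_
    rw [Finset.sum_comm (f := fun a k => ∑ l, B a j l * C a i k * p i * v j * p k * v l)]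
    refine Finset.sum_congr rfl fun k _ => ?_
    rw [Finset.sum_comm (f := fun a l => B a j l * C a i k * p i * v j * p k * v l)]
  simp only [mul_neg, Finset.sum_add_distrib, Finset.sum_neg_distrib]
  rw [← e1, ← e2, ← sub_eq_add_neg]
  simp only [← Finset.sum_sub_distrib]
  rw [Finset.mul_sum]
  refine Finset.sum_congr rfl fun i _ => ?_
  rw [Finset.mul_sum]
  refine Finset.sum_congr rfl fun j _ => ?_
  rw [Finset.mul_sum]
  refine Finset.sum_congr rfl fun k _ => ?_
  rw [Finset.mul_sum]
  exact Finset.sum_congr rfl fun l _ => by ring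

/-! ### Geodesics contained in a factor -/

/-- The geodesic equation for a curve in the coordinate space. -/
def GeodesicAt (φ : Coord n → ℝ) (η : ℝ → Coord n) (t : ℝ) : Prop :=
  ∀ A : Idx n, coordFun A (deriv (deriv η) t)
    + ∑ I, ∑ J, christoffel (potentialMetric φ) A I J (η t)
      * coordFun I (deriv η t) * coordFun J (deriv η t) = 0

variable {η : ℝ → Coord n} {t : ℝ}

/-- Contracting the geodesic equation with the mixed Hessian turns the Christoffel symbols into the
pure third derivatives `φ_{ikl̄}`. The result is the chain-rule expansion of the second derivative
of `∂φ/∂x^{l̄}`, so this covector component is affine. -/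
lemma GeodesicAt.deriv_deriv_pd_inr (h : GeodesicAt φ η t) (hφ : ContDiffAt ℝ 3 φ (η t))
    (hη : ContDiffAt ℝ 2 η t) (hz : IsUnit (mixedPd φ (η t)))
    (hv : ∀ j, coordFun (Sum.inr j) (deriv η t) = 0)
    (ha : ∀ j, coordFun (Sum.inr j) (deriv (deriv η) t) = 0) (l : Fin n) :
    HasDerivAt (deriv fun r => pd (Sum.inr l) φ (η r)) 0 t := by
  convert hasDerivAt_deriv_comp_curve (contDiffAt_pd hφ (m := 2) (by norm_num) (Sum.inr l)) hη using 1
  simp only [Fintype.sum_sum_type, hv, ha, mul_zero, Finset.sum_const_zero, add_zero]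
  have h1 : ∑ a, pd (Sum.inr l) (pd (Sum.inl a) φ) (η t) *
      (coordFun (Sum.inl a) (deriv (deriv η) t)
        + ∑ I, ∑ J, christoffel (potentialMetric φ) (Sum.inl a) I J (η t)
          * coordFun I (deriv η t) * coordFun J (deriv η t)) = 0 :=
    Finset.sum_eq_zero fun a _ => by rw [h (Sum.inl a), mul_zero]
  simp only [Fintype.sum_sum_type, hv, mul_zero, zero_mul, Finset.sum_const_zero, add_zero,
    mul_add, Finset.sum_add_distrib, Finset.mul_sum] at h1
  rw [Finset.sum_add_distrib, add_comm, ← h1]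
  congr 1
  · exact Finset.sum_congr rfl fun a _ => by
      rw [pd_comm (hφ.of_le (by norm_num)) (Sum.inr l) (Sum.inl a)]
  · rw [Finset.sum_comm]
    refine Finset.sum_congr rfl fun i _ => ?_
    rw [Finset.sum_comm, Finset.sum_mul]
    refine Finset.sum_congr rfl fun k _ => ?_
    have := sum_mixedPd_mul_christoffel hφ hz l (Sum.inl i) (Sum.inl k)
    simp only at this
    rw [pd_comm_outer hφ (Sum.inl k) (Sum.inl i), ← this, Finset.sum_mul, Finset.sum_mul]
    exact Finset.sum_congr rfl fun a _ => by ring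

lemma GeodesicAt.deriv_deriv_pd_inl (h : GeodesicAt φ η t) (hφ : ContDiffAt ℝ 3 φ (η t))
    (hη : ContDiffAt ℝ 2 η t) (hz : IsUnit (mixedPd φ (η t)))
    (hv : ∀ j, coordFun (Sum.inl j) (deriv η t) = 0)
    (ha : ∀ j, coordFun (Sum.inl j) (deriv (deriv η) t) = 0) (l : Fin n) :
    HasDerivAt (deriv fun r => pd (Sum.inl l) φ (η r)) 0 t := by
  convert hasDerivAt_deriv_comp_curve (contDiffAt_pd hφ (m := 2) (by norm_num) (Sum.inl l)) hη using 1
  simp only [Fintype.sum_sum_type, hv, ha, mul_zero, Finset.sum_const_zero, add_zero, zero_add]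
  have h1 : ∑ a, pd (Sum.inr a) (pd (Sum.inl l) φ) (η t) *
      (coordFun (Sum.inr a) (deriv (deriv η) t)
        + ∑ I, ∑ J, christoffel (potentialMetric φ) (Sum.inr a) I J (η t)
          * coordFun I (deriv η t) * coordFun J (deriv η t)) = 0 :=
    Finset.sum_eq_zero fun a _ => by rw [h (Sum.inr a), mul_zero]
  simp only [Fintype.sum_sum_type, hv, mul_zero, zero_mul, Finset.sum_const_zero, zero_add,
    mul_add, Finset.sum_add_distrib, Finset.mul_sum] at h1
  rw [Finset.sum_add_distrib, add_comm, ← h1]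
  congr 1
  rw [Finset.sum_comm]
  refine Finset.sum_congr rfl fun i _ => ?_
  rw [Finset.sum_comm, Finset.sum_mul]
  refine Finset.sum_congr rfl fun k _ => ?_
  have := sum_mixedPd_mul_christoffel' hφ hz l (Sum.inr i) (Sum.inr k)
  simp only at this
  rw [pd_comm_outer hφ (Sum.inr k) (Sum.inr i), ← this, Finset.sum_mul, Finset.sum_mul]
  exact Finset.sum_congr rfl fun a _ => by ring

/-- The second derivative in the second factor, in the direction `v`. -/
def hessInr (φ : Coord n → ℝ) (v : Fin n → ℝ) (z : Coord n) : ℝ :=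
  ∑ j, ∑ l, pd (Sum.inr j) (pd (Sum.inr l) φ) z * v j * v l

lemma contDiffAt_hessInr {k m : WithTop ℕ∞} (hφ : ContDiffAt ℝ k φ z) (h : m + 2 ≤ k)
    (v : Fin n → ℝ) : ContDiffAt ℝ m (hessInr φ v) z :=
  ContDiffAt.sum fun _ _ => ContDiffAt.sum fun _ _ =>
    ((contDiffAt_pd_pd hφ h _ _).mul contDiffAt_const).mul contDiffAt_const

lemma pd_hessInr (hφ : ContDiffAt ℝ 3 φ z) (v : Fin n → ℝ) (I : Idx n) :
    pd I (hessInr φ v) z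
      = ∑ j, ∑ l, pd I (pd (Sum.inr j) (pd (Sum.inr l) φ)) z * v j * v l := by
  have hd : ∀ j l, DifferentiableAt ℝ (pd (Sum.inr j) (pd (Sum.inr l) φ)) z := fun j l =>
    (contDiffAt_pd_pd hφ (m := 1) (by norm_num) _ _).differentiableAt (by simp)
  have h1 : hessInr φ v = fun w => ∑ j, ∑ l, (v j * v l) * pd (Sum.inr j) (pd (Sum.inr l) φ) w := by
    ext w
    exact Finset.sum_congr rfl fun j _ => Finset.sum_congr rfl fun l _ => by ring
  rw [h1, pd_fun_sum (F := fun j w => ∑ l, (v j * v l) * pd (Sum.inr j) (pd (Sum.inr l) φ) w)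
    fun j _ => DifferentiableAt.fun_sum fun l _ => (hd j l).const_mul _]
  refine Finset.sum_congr rfl fun j _ => ?_
  rw [pd_fun_sum (F := fun l w => (v j * v l) * pd (Sum.inr j) (pd (Sum.inr l) φ) w)
    fun l _ => (hd j l).const_mul _]
  refine Finset.sum_congr rfl fun l _ => ?_
  rw [pd_const_mul (hd j l)]
  ring

lemma pd_pd_hessInr (hφ : ContDiffAt ℝ 4 φ z) (v : Fin n → ℝ) (K I : Idx n) :
    pd K (pd I (hessInr φ v)) z
      = ∑ j, ∑ l, pd K (pd I (pd (Sum.inr j) (pd (Sum.inr l) φ))) z * v j * v l := by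
  have hd : ∀ j l, DifferentiableAt ℝ (pd I (pd (Sum.inr j) (pd (Sum.inr l) φ))) z := fun j l =>
    (contDiffAt_pd (contDiffAt_pd_pd hφ (m := 2) (by norm_num) _ _) (m := 1)
      (by norm_num) _).differentiableAt (by simp)
  have h1 : pd I (hessInr φ v) =ᶠ[𝓝 z]
      fun w => ∑ j, ∑ l, (v j * v l) * pd I (pd (Sum.inr j) (pd (Sum.inr l) φ)) w := by
    filter_upwards [(hφ.of_le (m := 3) (by norm_num)).eventually (by simp)] with w hw
    rw [pd_hessInr hw]
    exact Finset.sum_congr rfl fun j _ => Finset.sum_congr rfl fun l _ => by ring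
  rw [pd_congr h1,
    pd_fun_sum (F := fun j w => ∑ l, (v j * v l) * pd I (pd (Sum.inr j) (pd (Sum.inr l) φ)) w)
    fun j _ => DifferentiableAt.fun_sum fun l _ => (hd j l).const_mul _]
  refine Finset.sum_congr rfl fun j _ => ?_
  rw [pd_fun_sum (F := fun l w => (v j * v l) * pd I (pd (Sum.inr j) (pd (Sum.inr l) φ)) w)
    fun l _ => (hd j l).const_mul _]
  refine Finset.sum_congr rfl fun l _ => ?_
  rw [pd_const_mul (hd j l)]
  ring

/-- The curvature is a fourth derivative along a geodesic contained in the first factor. -/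
lemma GeodesicAt.deriv_deriv_hessInr (h : GeodesicAt φ η t) (hφ : ContDiffAt ℝ 4 φ (η t))
    (hη : ContDiffAt ℝ 2 η t) (hz : IsUnit (mixedPd φ (η t)))
    (hv : ∀ j, coordFun (Sum.inr j) (deriv η t) = 0)
    (ha : ∀ j, coordFun (Sum.inr j) (deriv (deriv η) t) = 0) (v : Fin n → ℝ) :
    HasDerivAt (deriv fun r => hessInr φ v (η r))
      (-2 * sec (potentialMetric φ) (η t)
        (Sum.elim (fun i => coordFun (Sum.inl i) (deriv η t)) 0) (Sum.elim 0 v)) t := by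
  convert hasDerivAt_deriv_comp_curve (contDiffAt_hessInr hφ (m := 2) (by norm_num) v) hη using 1
  set p : Fin n → ℝ := fun i => coordFun (Sum.inl i) (deriv η t) with hp
  have hφ3 : ContDiffAt ℝ 3 φ (η t) := hφ.of_le (by norm_num)
  have hacc : ∀ a, coordFun (Sum.inl a) (deriv (deriv η) t)
      = -∑ i, ∑ k, christoffel (potentialMetric φ) (Sum.inl a) (Sum.inl i) (Sum.inl k) (η t)
        * p i * p k := by
    intro a
    have := h (Sum.inl a)
    simp only [Fintype.sum_sum_type, hv, mul_zero, zero_mul, Finset.sum_const_zero,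
      add_zero] at this
    linarith
  -- The curvature formula and the chain rule list the four derivatives in different orders;
  -- symmetry of the fourth and third derivatives reconciles them.
  have h4 : ∀ i j k l : Idx n, pd j (pd i (pd k (pd l φ))) (η t)
      = pd k (pd i (pd j (pd l φ))) (η t) := by
    intro i j k l
    have hl : ContDiffAt ℝ 3 (pd l φ) (η t) := contDiffAt_pd hφ (by norm_num) l
    rw [pd_comm_outer hl j i k, pd_comm_inner hl i j k, pd_comm_outer hl i k j]
  have h3 : ∀ a j l : Idx n, pd j (pd l (pd a φ)) (η t) = pd a (pd j (pd l φ)) (η t) := by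
    intro a j l
    rw [pd_comm_inner hφ3 j l a, pd_comm_outer hφ3 j a l]
  rw [sec_mixed]
  simp only [riemann_mixed hφ hz, Fintype.sum_sum_type, hv, ha, mul_zero, Finset.sum_const_zero,
    add_zero, pd_hessInr hφ3, pd_pd_hessInr hφ]
  simp only [h4 (Sum.inl _) (Sum.inr _) (Sum.inl _), h3 (Sum.inl _), hacc]
  exact sum_quartic_rearrange (fun i j k l => pd (Sum.inl k)
    (pd (Sum.inl i) (pd (Sum.inr j) (pd (Sum.inr l) φ))) (η t))
    (fun a j l => pd (Sum.inl a) (pd (Sum.inr j) (pd (Sum.inr l) φ)) (η t))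
    (fun a i k => christoffel (potentialMetric φ) (Sum.inl a) (Sum.inl i) (Sum.inl k) (η t)) p v

end OffDiagonal

/-! ### One-dimensional calculus -/

section RealCalculus

/-- Near the base point `P` grows in `r` at speed at least `m` and `Q` is `K`-Lipschitz in `r`.
Hence `P · t` has a zero `r` with `|r| ≤ |P 0 t| / m`; there `Q ≤ 0`, and returning to `r = 0` costs
at most `K |r|`. -/
lemma le_mul_abs_of_zero_imp_of_pos {P Q dP dQ : ℝ → ℝ → ℝ} {t₀ : ℝ}
    (hP : ∀ᶠ q : ℝ × ℝ in 𝓝 (0, t₀), HasDerivAt (fun r => P r q.2) (dP q.1 q.2) q.1)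
    (hQ : ∀ᶠ q : ℝ × ℝ in 𝓝 (0, t₀), HasDerivAt (fun r => Q r q.2) (dQ q.1 q.2) q.1)
    (hdP : ContinuousAt (fun q : ℝ × ℝ => dP q.1 q.2) (0, t₀))
    (hdQ : ContinuousAt (fun q : ℝ × ℝ => dQ q.1 q.2) (0, t₀))
    (hpos : 0 < dP 0 t₀) (hP₀ : ContinuousAt (P 0) t₀) (hz : P 0 t₀ = 0)
    (himp : ∀ᶠ q : ℝ × ℝ in 𝓝 (0, t₀), P q.1 q.2 = 0 → Q q.1 q.2 ≤ 0) :
    ∃ C, ∀ᶠ t in 𝓝 t₀, Q 0 t ≤ C * |P 0 t| := by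
  set m := dP 0 t₀ / 2 with hm
  set K := |dQ 0 t₀| + 1 with hK
  have hm0 : 0 < m := by positivity
  have hK0 : 0 < K := by positivity
  have hall : ∀ᶠ q : ℝ × ℝ in 𝓝 (0, t₀), HasDerivAt (fun r => P r q.2) (dP q.1 q.2) q.1 ∧
      HasDerivAt (fun r => Q r q.2) (dQ q.1 q.2) q.1 ∧ m ≤ dP q.1 q.2 ∧ |dQ q.1 q.2| ≤ K ∧
      (P q.1 q.2 = 0 → Q q.1 q.2 ≤ 0) := by
    have h1 : ∀ᶠ q : ℝ × ℝ in 𝓝 (0, t₀), m < dP q.1 q.2 :=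
      hdP.eventually (lt_mem_nhds (by simp only [hm]; linarith))
    have h2 : ∀ᶠ q : ℝ × ℝ in 𝓝 (0, t₀), |dQ q.1 q.2| < K :=
      hdQ.abs.eventually (gt_mem_nhds (by simp [hK]))
    filter_upwards [hP, hQ, h1, h2, himp] with q a b c d e using ⟨a, b, c.le, d.le, e⟩
  rw [nhds_prod_eq] at hall
  obtain ⟨p₁, hp₁, p₂, hp₂, hp⟩ := Filter.eventually_prod_iff.1 hall
  obtain ⟨δ, hδ, hball⟩ := Metric.eventually_nhds_iff.1 hp₁
  have hr : ∀ r : ℝ, |r| < δ → p₁ r := fun r h => hball (by simpa [Real.dist_eq] using h)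
  refine ⟨K / m, ?_⟩
  -- This keeps the radius `ρ = |P 0 t| / m` below `δ`, inside the region where the bounds hold.
  have hsmall : ∀ᶠ t in 𝓝 t₀, |P 0 t| < m * (δ / 2) :=
    hP₀.abs.eventually (gt_mem_nhds (by simp only [hz, abs_zero]; positivity))
  filter_upwards [hp₂, hsmall] with t ht hs
  set ρ := |P 0 t| / m with hρ
  have hρ0 : 0 ≤ ρ := by positivity
  have hρδ : ρ < δ := by
    rw [hρ, div_lt_iff₀ hm0]
    nlinarith
  have hin : ∀ r ∈ Icc (-ρ) ρ, p₁ r := fun r h => hr r ((abs_le.2 h).trans_lt hρδ)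
  have hPc : ContinuousOn (fun r => P r t) (Icc (-ρ) ρ) := fun r h =>
    (hp (hin r h) ht).1.continuousAt.continuousWithinAt
  have hmρ : m * ρ = |P 0 t| := by rw [hρ]; field_simp
  have hup : 0 ≤ P ρ t := by
    have := (convex_Icc (-ρ) ρ).mul_sub_le_image_sub_of_le_deriv (f := fun r => P r t) (C := m) hPc
      (fun r h => (hp (hin r (interior_subset h)) ht).1.differentiableAt.differentiableWithinAt)
      (fun r h => by
        rw [(hp (hin r (interior_subset h)) ht).1.deriv]
        exact (hp (hin r (interior_subset h)) ht).2.2.1)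
      0 ⟨by linarith, hρ0⟩ ρ ⟨by linarith, le_rfl⟩ hρ0
    have h2 := neg_abs_le (P 0 t)
    simp only [sub_zero] at this
    linarith
  have hdown : P (-ρ) t ≤ 0 := by
    have := (convex_Icc (-ρ) ρ).mul_sub_le_image_sub_of_le_deriv (f := fun r => P r t) (C := m) hPc
      (fun r h => (hp (hin r (interior_subset h)) ht).1.differentiableAt.differentiableWithinAt)
      (fun r h => by
        rw [(hp (hin r (interior_subset h)) ht).1.deriv]
        exact (hp (hin r (interior_subset h)) ht).2.2.1)
      (-ρ) ⟨le_rfl, by linarith⟩ 0 ⟨by linarith, hρ0⟩ (by linarith)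
    have h2 := le_abs_self (P 0 t)
    simp only [zero_sub, neg_neg] at this
    linarith
  obtain ⟨r, hrI, hr0⟩ := intermediate_value_Icc (by linarith) hPc ⟨hdown, hup⟩
  have hQr : Q r t ≤ 0 := (hp (hin r hrI) ht).2.2.2.2 hr0
  have hlip := (convex_Icc (-ρ) ρ).norm_image_sub_le_of_norm_hasDerivWithin_le
    (f := fun r => Q r t) (f' := fun r => dQ r t) (C := K)
    (fun r h => (hp (hin r h) ht).2.1.hasDerivWithinAt)
    (fun r h => (hp (hin r h) ht).2.2.2.1) hrI (show (0 : ℝ) ∈ Icc (-ρ) ρ from ⟨by linarith, hρ0⟩)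
  simp only [Real.norm_eq_abs, zero_sub, abs_neg] at hlip
  have h3 : |r| ≤ ρ := abs_le.2 hrI
  have h4 : K * |r| ≤ K * ρ := by gcongr
  have h5 := le_abs_self (Q 0 t - Q r t)
  have h6 : K / m * |P 0 t| = K * ρ := by rw [hρ]; ring
  rw [h6]
  linarith

/-- If `Q ≤ 0` wherever `P = 0`, and `P` can be moved to zero at nonzero speed by a parameter `r`,
then `Q` is bounded above by a multiple of `|P|`. -/
lemma le_mul_abs_of_zero_imp {P Q dP dQ : ℝ → ℝ → ℝ} {t₀ : ℝ}
    (hP : ∀ᶠ q : ℝ × ℝ in 𝓝 (0, t₀), HasDerivAt (fun r => P r q.2) (dP q.1 q.2) q.1)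
    (hQ : ∀ᶠ q : ℝ × ℝ in 𝓝 (0, t₀), HasDerivAt (fun r => Q r q.2) (dQ q.1 q.2) q.1)
    (hdP : ContinuousAt (fun q : ℝ × ℝ => dP q.1 q.2) (0, t₀))
    (hdQ : ContinuousAt (fun q : ℝ × ℝ => dQ q.1 q.2) (0, t₀))
    (hne : dP 0 t₀ ≠ 0) (hP₀ : ContinuousAt (P 0) t₀) (hz : P 0 t₀ = 0)
    (himp : ∀ᶠ q : ℝ × ℝ in 𝓝 (0, t₀), P q.1 q.2 = 0 → Q q.1 q.2 ≤ 0) :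
    ∃ C, ∀ᶠ t in 𝓝 t₀, Q 0 t ≤ C * |P 0 t| := by
  rcases hne.lt_or_gt with h | h
  · have := le_mul_abs_of_zero_imp_of_pos (P := fun r t => -P r t) (dP := fun r t => -dP r t)
      (hP.mono fun q hq => hq.neg) hQ hdP.neg hdQ (by simpa using h) hP₀.neg (by simp [hz])
      (himp.mono fun q hq h0 => hq (by simpa using h0))
    simpa only [abs_neg] using this
  · exact le_mul_abs_of_zero_imp_of_pos hP hQ hdP hdQ h hP₀ hz himp

/-- A one-sided Gronwall argument: the barriers `η exp(k (t - t₀))` with `η > 0` lie above `g`, and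
`η` is arbitrary. -/
lemma nonpos_right_of_deriv_le_mul_abs {g g' : ℝ → ℝ} {t₀ C : ℝ}
    (hg : ∀ᶠ t in 𝓝 t₀, HasDerivAt g (g' t) t) (hle : ∀ᶠ t in 𝓝 t₀, g' t ≤ C * |g t|)
    (h0 : g t₀ = 0) : ∃ δ > 0, ∀ t ∈ Icc t₀ (t₀ + δ), HasDerivAt g (g' t) t ∧ g t ≤ 0 := by
  obtain ⟨ε, hε, hball⟩ := Metric.eventually_nhds_iff.1 (hg.and hle)
  have hmem : ∀ t ∈ Icc t₀ (t₀ + ε / 2), HasDerivAt g (g' t) t ∧ g' t ≤ C * |g t| := fun t ht =>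
    hball (by rw [Real.dist_eq, abs_of_nonneg (by linarith [ht.1])]; linarith [ht.2])
  refine ⟨ε / 2, by positivity, fun t ht => ⟨(hmem t ht).1, ?_⟩⟩
  -- Any rate larger than `|C|` works: where `g` touches the barrier it is positive, and the barrier
  -- has strictly larger slope.
  set k := |C| + 1 with hk
  have key : ∀ η > 0, g t ≤ η * Real.exp (k * (t - t₀)) := by
    intro η hη
    refine image_le_of_deriv_right_lt_deriv_boundary (f := g) (f' := g')
      (B := fun s => η * Real.exp (k * (s - t₀)))
      (B' := fun s => η * (Real.exp (k * (s - t₀)) * k))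
      (fun s hs => (hmem s hs).1.continuousAt.continuousWithinAt)
      (fun s hs => (hmem s (Ico_subset_Icc_self hs)).1.hasDerivWithinAt)
      (by simp [h0, hη.le]) (fun s => ?_) (fun s hs heq => ?_) ht
    · have : HasDerivAt (fun s => k * (s - t₀)) k s := by
        simpa using ((hasDerivAt_id s).sub_const t₀).const_mul k
      exact this.exp.const_mul η
    · have hp : 0 < g s := by rw [heq]; positivity
      have h1 := (hmem s (Ico_subset_Icc_self hs)).2
      rw [abs_of_pos hp] at h1
      have h2 : C * g s ≤ |C| * g s := by gcongr; exact le_abs_self C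
      have h3 : η * (Real.exp (k * (s - t₀)) * k) = k * g s := by rw [heq]; ring
      rw [h3, hk]
      linarith
  by_contra! hpos
  -- With this `η` the barrier takes the value `g t / 2` at time `t`.
  have h1 := key (g t / 2 * Real.exp (-(k * (t - t₀)))) (by positivity)
  rw [mul_assoc, ← Real.exp_add, neg_add_cancel, Real.exp_zero] at h1
  linarith

/-- A minimum principle: if `k'' ≤ C |k'|` near each critical point, then `k` has no strict
interior minimum. -/
lemma min_le_of_deriv_deriv_le {k g g' : ℝ → ℝ} {a d : ℝ}
    (hk : ∀ t ∈ Icc a d, HasDerivAt k (g t) t)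
    (hg : ∀ t ∈ Ioo a d, HasDerivAt g (g' t) t)
    (hle : ∀ t ∈ Ioo a d, g t = 0 → ∃ C, ∀ᶠ s in 𝓝 t, g' s ≤ C * |g s|) {t : ℝ}
    (ht : t ∈ Icc a d) : min (k a) (k d) ≤ k t := by
  by_contra! hlt
  have hkc : ContinuousOn k (Icc a d) := fun s hs => (hk s hs).continuousAt.continuousWithinAt
  obtain ⟨s₀, hs₀, hmin⟩ := isCompact_Icc.exists_isMinOn ⟨t, ht⟩ hkc
  have hcomp : IsCompact (Icc a d ∩ k ⁻¹' {k s₀}) :=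
    isCompact_Icc.of_isClosed_subset (hkc.preimage_isClosed_of_isClosed isClosed_Icc
      isClosed_singleton) inter_subset_left
  -- `s` is the last point where the minimum is attained. As `k` cannot increase just after it, a
  -- later minimum point appears.
  obtain ⟨s, ⟨hs, hks⟩, hmax⟩ := hcomp.exists_isMaxOn ⟨s₀, hs₀, rfl⟩ continuous_id.continuousOn
  have hks' : k s = k s₀ := hks
  have hle_s : ∀ r ∈ Icc a d, k s ≤ k r := fun r hr => hks' ▸ hmin hr
  have hst := hle_s t ht
  have hsa : s ≠ a := by
    rintro rfl
    exact absurd (hlt.trans_le (min_le_left _ _)) (not_lt.2 hst)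
  have hsd : s ≠ d := by
    rintro rfl
    exact absurd (hlt.trans_le (min_le_right _ _)) (not_lt.2 hst)
  have hsI : s ∈ Ioo a d := ⟨lt_of_le_of_ne hs.1 hsa.symm, lt_of_le_of_ne hs.2 hsd⟩
  have hloc : IsLocalMin k s := by
    filter_upwards [Icc_mem_nhds hsI.1 hsI.2] with r hr using hle_s r hr
  have hgs : g s = 0 := hloc.hasDerivAt_eq_zero (hk s hs)
  obtain ⟨C, hC⟩ := hle s hsI hgs
  obtain ⟨δ, hδ, hneg⟩ := nonpos_right_of_deriv_le_mul_abs
    (Filter.eventually_of_mem (Ioo_mem_nhds hsI.1 hsI.2) hg) hC hgs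
  set r := min (s + δ) d with hr
  have hsr : s < r := lt_min (by linarith) hsI.2
  have hsub : Icc s r ⊆ Icc a d := Icc_subset_Icc hs.1 (min_le_right _ _)
  have hanti : AntitoneOn k (Icc s r) := by
    refine antitoneOn_of_deriv_nonpos (convex_Icc _ _) (hkc.mono hsub)
      (fun y hy => (hk y (hsub (interior_subset hy))).differentiableAt.differentiableWithinAt)
      (fun y hy => ?_)
    rw [(hk y (hsub (interior_subset hy))).deriv]
    have hy' := interior_subset hy
    exact (hneg y ⟨hy'.1, hy'.2.trans (min_le_left _ _)⟩).2
  have hkr : k r ≤ k s := hanti ⟨le_rfl, hsr.le⟩ ⟨hsr.le, le_rfl⟩ hsr.le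
  have hrI : r ∈ Icc a d := hsub ⟨hsr.le, le_rfl⟩
  have : r ≤ s := hmax ⟨hrI, (le_antisymm hkr (hle_s r hrI)).trans hks'⟩
  linarith

lemma deriv_eq_of_hasDerivAt_deriv_zero {g : ℝ → ℝ} {a b : ℝ}
    (hg : ∀ s ∈ Ioo a b, HasDerivAt g 0 s) {s t : ℝ} (hs : s ∈ Ioo a b) (ht : t ∈ Ioo a b) :
    g s = g t :=
  isOpen_Ioo.is_const_of_deriv_eq_zero isPreconnected_Ioo
    (fun r hr => (hg r hr).differentiableAt.differentiableWithinAt)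
    (fun r hr => (hg r hr).deriv) hs ht

/-- Rolle's theorem provides one zero of the derivative, and the derivative is constant. -/
lemma deriv_eq_zero_of_affine {e g : ℝ → ℝ} (hc : ContinuousOn e (Icc 0 1))
    (he : ∀ s ∈ Ioo (0 : ℝ) 1, HasDerivAt e (g s) s)
    (hg : ∀ s ∈ Ioo (0 : ℝ) 1, HasDerivAt g 0 s) (h01 : e 0 = e 1) {s : ℝ}
    (hs : s ∈ Ioo (0 : ℝ) 1) : g s = 0 := by
  obtain ⟨r, hr, hr0⟩ := exists_hasDerivAt_eq_zero zero_lt_one hc h01 he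
  rw [deriv_eq_of_hasDerivAt_deriv_zero hg hs hr, hr0]

/-- A decreasing derivative lies below its limit at the left end. Only the limit is used, since
horizontal geodesics are merely continuous at their endpoints. -/
lemma le_of_concave_of_deriv_tendsto_zero {e g g' : ℝ → ℝ} (hc : ContinuousOn e (Icc 0 1))
    (he : ∀ s ∈ Ioo (0 : ℝ) 1, HasDerivAt e (g s) s)
    (hg : ∀ s ∈ Ioo (0 : ℝ) 1, HasDerivAt g (g' s) s)
    (hg' : ∀ s ∈ Ioo (0 : ℝ) 1, g' s ≤ 0)
    (hlim : Filter.Tendsto g (𝓝[>] 0) (𝓝 0)) : e 1 ≤ e 0 := by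
  have hanti : AntitoneOn g (Ioo 0 1) := by
    refine antitoneOn_of_deriv_nonpos (convex_Ioo _ _)
      (fun s hs => (hg s hs).continuousAt.continuousWithinAt) ?_ ?_ <;> rw [interior_Ioo]
    · exact fun s hs => (hg s hs).differentiableAt.differentiableWithinAt
    · exact fun s hs => by rw [(hg s hs).deriv]; exact hg' s hs
  have hle : ∀ s ∈ Ioo (0 : ℝ) 1, g s ≤ 0 := by
    intro s hs
    refine ge_of_tendsto hlim ?_
    filter_upwards [Ioo_mem_nhdsGT hs.1] with r hr
    exact hanti ⟨hr.1, hr.2.trans hs.2⟩ hs hr.2.le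
  have : AntitoneOn e (Icc 0 1) := by
    refine antitoneOn_of_deriv_nonpos (convex_Icc _ _) hc ?_ ?_ <;> rw [interior_Icc]
    · exact fun s hs => (he s hs).differentiableAt.differentiableWithinAt
    · exact fun s hs => by rw [(he s hs).deriv]; exact hle s hs
  exact this (by simp) (by simp) zero_le_one

end RealCalculus

/-! ### Time derivatives of the potential along a curve in the second factor. -/

section VerticalCoordinates

variable {n : ℕ}

/-- The velocity of `φ (z, ζ t)` in `t`, as a function of `(z, ζ t)` and the velocity `v`. -/
def velInr (φ : Coord n → ℝ) (v : EuclideanSpace ℝ (Fin n)) (z : Coord n) : ℝ :=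
  ∑ j, pd (Sum.inr j) φ z * v j

/-- The acceleration of `φ (z, ζ t)` in `t`, as a function of `(z, ζ t)`, the velocity `v` and the
acceleration `a`. -/
def accInr (φ : Coord n → ℝ) (v a : EuclideanSpace ℝ (Fin n)) (z : Coord n) : ℝ :=
  hessInr φ v z + velInr φ a z

variable {φ : Coord n → ℝ} {z : Coord n}

lemma contDiffAt_velInr {k m : WithTop ℕ∞} (hφ : ContDiffAt ℝ k φ z) (h : m + 1 ≤ k)
    (v : EuclideanSpace ℝ (Fin n)) : ContDiffAt ℝ m (velInr φ v) z :=
  ContDiffAt.sum fun _ _ => (contDiffAt_pd hφ h _).mul contDiffAt_const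

lemma contDiffAt_accInr {k m : WithTop ℕ∞} (hφ : ContDiffAt ℝ k φ z) (h : m + 2 ≤ k)
    (v a : EuclideanSpace ℝ (Fin n)) : ContDiffAt ℝ m (accInr φ v a) z :=
  (contDiffAt_hessInr hφ h v).add (contDiffAt_velInr hφ
    (le_trans (by gcongr; exact one_le_two) h) a)

lemma pd_velInr (hφ : ContDiffAt ℝ 2 φ z) (v : EuclideanSpace ℝ (Fin n)) (I : Idx n) :
    pd I (velInr φ v) z = ∑ j, pd I (pd (Sum.inr j) φ) z * v j := by
  have hd : ∀ j, DifferentiableAt ℝ (pd (Sum.inr j) φ) z := fun j =>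
    (contDiffAt_pd hφ (m := 1) (by norm_num) _).differentiableAt (by simp)
  have h1 : velInr φ v = fun w => ∑ j, v j * pd (Sum.inr j) φ w := by
    ext w
    exact Finset.sum_congr rfl fun j _ => mul_comm _ _
  rw [h1, pd_fun_sum (F := fun j w => v j * pd (Sum.inr j) φ w) fun j _ => (hd j).const_mul _]
  exact Finset.sum_congr rfl fun j _ => by rw [pd_const_mul (hd j), mul_comm]

lemma deriv_prodMk_const_left {ζ : ℝ → EuclideanSpace ℝ (Fin n)} {t : ℝ}
    (hζ : DifferentiableAt ℝ ζ t) (w : EuclideanSpace ℝ (Fin n)) :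
    deriv (fun τ => ((w, ζ τ) : Coord n)) t = (0, deriv ζ t) :=
  ((hasDerivAt_const t w).prodMk hζ.hasDerivAt).deriv

lemma deriv_prodMk_const_right {ζ : ℝ → EuclideanSpace ℝ (Fin n)} {t : ℝ}
    (hζ : DifferentiableAt ℝ ζ t) (w : EuclideanSpace ℝ (Fin n)) :
    deriv (fun τ => ((ζ τ, w) : Coord n)) t = (deriv ζ t, 0) :=
  (hζ.hasDerivAt.prodMk (hasDerivAt_const t w)).deriv

lemma deriv_deriv_prodMk_const_left {ζ : ℝ → EuclideanSpace ℝ (Fin n)} {t : ℝ}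
    (hζ : ContDiffAt ℝ 2 ζ t) (w : EuclideanSpace ℝ (Fin n)) :
    deriv (deriv fun τ => ((w, ζ τ) : Coord n)) t = (0, deriv (deriv ζ) t) := by
  have h : deriv (fun τ => ((w, ζ τ) : Coord n)) =ᶠ[𝓝 t] fun τ => (0, deriv ζ τ) := by
    filter_upwards [hζ.eventually (by simp)] with τ hτ
    exact deriv_prodMk_const_left (hτ.differentiableAt (by simp)) w
  rw [h.deriv_eq]
  exact ((hasDerivAt_const t (0 : EuclideanSpace ℝ (Fin n))).prodMk (hasDerivAt_deriv hζ)).deriv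

lemma deriv_deriv_prodMk_const_right {ζ : ℝ → EuclideanSpace ℝ (Fin n)} {t : ℝ}
    (hζ : ContDiffAt ℝ 2 ζ t) (w : EuclideanSpace ℝ (Fin n)) :
    deriv (deriv fun τ => ((ζ τ, w) : Coord n)) t = (deriv (deriv ζ) t, 0) := by
  have h : deriv (fun τ => ((ζ τ, w) : Coord n)) =ᶠ[𝓝 t] fun τ => (deriv ζ τ, 0) := by
    filter_upwards [hζ.eventually (by simp)] with τ hτ
    exact deriv_prodMk_const_right (hτ.differentiableAt (by simp)) w
  rw [h.deriv_eq]
  exact ((hasDerivAt_deriv hζ).prodMk (hasDerivAt_const t (0 : EuclideanSpace ℝ (Fin n)))).deriv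

lemma hasDerivAt_vertical {ζ : ℝ → EuclideanSpace ℝ (Fin n)} {t : ℝ}
    {w : EuclideanSpace ℝ (Fin n)} (hφ : ContDiffAt ℝ 1 φ (w, ζ t)) (hζ : ContDiffAt ℝ 1 ζ t) :
    HasDerivAt (fun τ => φ (w, ζ τ)) (velInr φ (deriv ζ t) (w, ζ t)) t := by
  have h := hasDerivAt_comp_curve (η := fun τ => (w, ζ τ)) (hφ.differentiableAt (by simp))
    ((hasDerivAt_const t w).prodMk (hζ.differentiableAt (by simp)).hasDerivAt)
  simpa [Fintype.sum_sum_type, coordFun, velInr] using h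

lemma hasDerivAt_deriv_vertical {ζ : ℝ → EuclideanSpace ℝ (Fin n)} {t : ℝ}
    {w : EuclideanSpace ℝ (Fin n)} (hφ : ContDiffAt ℝ 2 φ (w, ζ t)) (hζ : ContDiffAt ℝ 2 ζ t) :
    HasDerivAt (deriv fun τ => φ (w, ζ τ))
      (accInr φ (deriv ζ t) (deriv (deriv ζ) t) (w, ζ t)) t := by
  have h := hasDerivAt_deriv_comp_curve (η := fun τ => (w, ζ τ)) hφ (contDiffAt_const.prodMk hζ)
  rw [deriv_prodMk_const_left (hζ.differentiableAt (by simp)),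
    deriv_deriv_prodMk_const_left hζ] at h
  convert h using 1
  simp only [Fintype.sum_sum_type, coordFun, accInr, hessInr, velInr, PiLp.zero_apply, mul_zero,
    Finset.sum_const_zero, zero_add, Finset.sum_add_distrib]
  congr 1
  rw [Finset.sum_comm]
  exact Finset.sum_congr rfl fun j _ => by rw [Finset.sum_mul]

/-- Along a geodesic in the second factor, the acceleration of the potential is stationary in the
first factor. -/
lemma GeodesicAt.pd_inl_accInr {ζ : ℝ → EuclideanSpace ℝ (Fin n)} {t : ℝ}
    {w : EuclideanSpace ℝ (Fin n)} (h : GeodesicAt φ (fun τ => (w, ζ τ)) t)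
    (hφ : ContDiffAt ℝ 4 φ (w, ζ t)) (hζ : ContDiffAt ℝ 2 ζ t)
    (hz : IsUnit (mixedPd φ (w, ζ t))) (i : Fin n) :
    pd (Sum.inl i) (accInr φ (deriv ζ t) (deriv (deriv ζ) t)) (w, ζ t) = 0 := by
  have hφ3 : ContDiffAt ℝ 3 φ (w, ζ t) := hφ.of_le (by norm_num)
  have h0 := h.deriv_deriv_pd_inl hφ3 (contDiffAt_const.prodMk hζ) hz
    (fun j => by
      rw [deriv_prodMk_const_left (hζ.differentiableAt (by simp))]
      simp [coordFun])
    (fun j => by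
      rw [deriv_deriv_prodMk_const_left hζ]
      simp [coordFun]) i
  have h1 := hasDerivAt_deriv_vertical (φ := pd (Sum.inl i) φ) (w := w)
    (contDiffAt_pd hφ3 (by norm_num) _) hζ
  -- The zero on the right is the second time derivative of `∂φ/∂xⁱ` along the geodesic; it remains
  -- to commute `∂/∂xⁱ` with the barred derivatives.
  rw [h0.unique h1]
  set v := deriv ζ t
  set a := deriv (deriv ζ) t
  have hadd : pd (Sum.inl i) (accInr φ v a) (w, ζ t)
      = pd (Sum.inl i) (hessInr φ v) (w, ζ t) + pd (Sum.inl i) (velInr φ a) (w, ζ t) := by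
    have e1 := (contDiffAt_hessInr hφ3 (m := 1) (by norm_num) v).differentiableAt (by simp)
    have e2 := (contDiffAt_velInr hφ3 (m := 1) (by norm_num) a).differentiableAt (by simp)
    change fderiv ℝ (fun w => hessInr φ v w + velInr φ a w) (w, ζ t) _ = _
    rw [fderiv_fun_add e1 e2]
    rfl
  rw [hadd, pd_hessInr hφ3, pd_velInr (hφ.of_le (by norm_num))]
  unfold accInr hessInr velInr
  congr 1
  · refine Finset.sum_congr rfl fun j _ => Finset.sum_congr rfl fun l _ => ?_
    rw [pd_comm_outer hφ3 (Sum.inl i), pd_comm_inner hφ3 (Sum.inr j) (Sum.inl i)]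
  · exact Finset.sum_congr rfl fun j _ => by rw [pd_comm (hφ.of_le (by norm_num)) (Sum.inl i)]

end VerticalCoordinates

/-! ### Costs in charts -/

section Charts

variable {n : ℕ} {M M' : Type*}
  [TopologicalSpace M] [ChartedSpace (EuclideanSpace ℝ (Fin n)) M]
  [TopologicalSpace M'] [ChartedSpace (EuclideanSpace ℝ (Fin n)) M']
  {f : M × M' → ℝ} {N : Set (M × M')}

lemma isUnit_mixedPd (hnd : Nondegenerate n f N) {p : M × M'} (hp : p ∈ N) :
    IsUnit (mixedPd (n := n) (inCoord f p) (toCoord p p)) :=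
  Matrix.mulVec_injective_iff_isUnit.1 (hnd p hp).1

lemma eventually_inCoord_eq (f : M × M' → ℝ) (p : M × M') :
    ∀ᶠ q in 𝓝 p, inCoord f p (toCoord (n := n) p q) = f q := by
  have h1 : ∀ᶠ q : M × M' in 𝓝 p, q.1 ∈ (extChartAt (𝓡 n) p.1).source :=
    continuousAt_fst.eventually (extChartAt_source_mem_nhds p.1)
  have h2 : ∀ᶠ q : M × M' in 𝓝 p, q.2 ∈ (extChartAt (𝓡 n) p.2).source :=
    continuousAt_snd.eventually (extChartAt_source_mem_nhds p.2)
  filter_upwards [h1, h2] with q hq1 hq2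
  simp only [inCoord, toCoord, (extChartAt (𝓡 n) p.1).left_inv hq1,
    (extChartAt (𝓡 n) p.2).left_inv hq2]

lemma continuousAt_toCoord (p : M × M') : ContinuousAt (toCoord (n := n) p) p :=
  ((continuousAt_extChartAt (I := 𝓡 n) p.1).comp continuousAt_fst).prodMk
    ((continuousAt_extChartAt (I := 𝓡 n) p.2).comp continuousAt_snd)

lemma GeodesicEqAt.geodesicAt {σ : ℝ → M × M'} {t : ℝ} (h : GeodesicEqAt n f σ t)
    (hσ : ContDiffAt ℝ 2 (fun r => toCoord (n := n) (σ t) (σ r)) t) :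
    GeodesicAt (inCoord f (σ t)) (fun r => toCoord (n := n) (σ t) (σ r)) t := by
  intro A
  have h1 := h A
  rw [deriv_deriv_coordFun hσ] at h1
  simp only [(deriv_coordFun_eventuallyEq (hσ.of_le (by norm_num)) _).eq_of_nhds] at h1
  -- `costMetric f p` is by definition the potential metric of `inCoord f p`.
  exact h1

lemma contDiffAt_chart_comp [IsManifold (𝓡 n) ∞ M] {X : ℝ → M} {s : ℝ} {x₀ : M}
    (hX : ContMDiffAt 𝓘(ℝ, ℝ) (𝓡 n) 2 X s) (hs : X s ∈ (extChartAt (𝓡 n) x₀).source) :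
    ContDiffAt ℝ 2 (fun r => extChartAt (𝓡 n) x₀ (X r)) s := by
  rw [extChartAt_source] at hs
  exact ((contMDiffAt_extChartAt' hs).comp s hX).contDiffAt

variable [IsManifold (𝓡 n) ∞ M] [IsManifold (𝓡 n) ∞ M']

lemma contDiffAt_inCoord (hN : IsOpen N)
    (hf : ContMDiffOn ((𝓡 n).prod (𝓡 n)) 𝓘(ℝ, ℝ) 4 f N) {p : M × M'} (hp : p ∈ N) :
    ContDiffAt ℝ 4 (inCoord (n := n) f p) (toCoord p p) := by
  have h1 : ContMDiffAt 𝓘(ℝ, Coord n) (𝓡 n) 4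
      (fun z : Coord n => (extChartAt (𝓡 n) p.1).symm z.1) (toCoord p p) :=
    ((contMDiffOn_extChartAt_symm (n := 4) p.1).contMDiffAt
      (extChartAt_target_mem_nhds p.1)).comp (toCoord (n := n) p p)
      (contDiff_fst.contMDiff.contMDiffAt)
  have h2 : ContMDiffAt 𝓘(ℝ, Coord n) (𝓡 n) 4
      (fun z : Coord n => (extChartAt (𝓡 n) p.2).symm z.2) (toCoord p p) :=
    ((contMDiffOn_extChartAt_symm (n := 4) p.2).contMDiffAt
      (extChartAt_target_mem_nhds p.2)).comp (toCoord (n := n) p p)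
      (contDiff_snd.contMDiff.contMDiffAt)
  have h3 : ContMDiffAt ((𝓡 n).prod (𝓡 n)) 𝓘(ℝ, ℝ) 4 f
      ((extChartAt (𝓡 n) p.1).symm (toCoord (n := n) p p).1,
        (extChartAt (𝓡 n) p.2).symm (toCoord (n := n) p p).2) := by
    simp only [toCoord, extChartAt_to_inv]
    exact hf.contMDiffAt (hN.mem_nhds hp)
  exact (h3.comp (toCoord (n := n) p p) (h1.prodMk h2)).contDiffAt

/-- Time derivatives of `f (y, β t)`, computed in charts. -/
lemma eventually_hasDerivAt_vertical (hN : IsOpen N)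
    (hf : ContMDiffOn ((𝓡 n).prod (𝓡 n)) 𝓘(ℝ, ℝ) 4 f N) {β : ℝ → M'} {t₀ : ℝ}
    (hβ : ContMDiffAt 𝓘(ℝ, ℝ) (𝓡 n) 2 β t₀) {y₀ : M} (hp : (y₀, β t₀) ∈ N) :
    let φ := inCoord f (y₀, β t₀)
    let ζ := fun τ => extChartAt (𝓡 n) (β t₀) (β τ)
    ∀ᶠ q : M × ℝ in 𝓝 (y₀, t₀),
      HasDerivAt (fun τ => f (q.1, β τ))
        (velInr φ (deriv ζ q.2) (extChartAt (𝓡 n) y₀ q.1, ζ q.2)) q.2 ∧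
      HasDerivAt (deriv fun τ => f (q.1, β τ))
        (accInr φ (deriv ζ q.2) (deriv (deriv ζ) q.2) (extChartAt (𝓡 n) y₀ q.1, ζ q.2)) q.2 := by
  intro φ ζ
  have hmap : ContinuousAt (fun q : M × ℝ => (q.1, β q.2)) (y₀, t₀) :=
    continuousAt_fst.prodMk (ContinuousAt.comp (f := Prod.snd) (g := β) hβ.continuousAt
      continuousAt_snd)
  have hA : ∀ᶠ q : M × ℝ in 𝓝 (y₀, t₀),
      φ (extChartAt (𝓡 n) y₀ q.1, ζ q.2) = f (q.1, β q.2) :=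
    hmap.eventually (eventually_inCoord_eq f (y₀, β t₀))
  have hB : ∀ᶠ q : M × ℝ in 𝓝 (y₀, t₀),
      ContDiffAt ℝ 4 φ (extChartAt (𝓡 n) y₀ q.1, ζ q.2) :=
    (ContinuousAt.comp (f := fun q : M × ℝ => (q.1, β q.2)) (x := (y₀, t₀))
      (g := toCoord (n := n) (y₀, β t₀)) (continuousAt_toCoord _) hmap).eventually
      ((contDiffAt_inCoord hN hf hp).eventually (by simp))
  have hC : ∀ᶠ q : M × ℝ in 𝓝 (y₀, t₀), ContDiffAt ℝ 2 ζ q.2 :=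
    continuousAt_snd.eventually
      ((contDiffAt_chart_comp hβ (mem_extChartAt_source (β t₀))).eventually (by simp))
  filter_upwards [eventually_eventually_nhds.2 hA, hB, hC] with q hq1 hq2 hq3
  have hloc : (fun τ => f (q.1, β τ)) =ᶠ[𝓝 q.2]
      fun τ => φ (extChartAt (𝓡 n) y₀ q.1, ζ τ) := by
    have : ContinuousAt (fun τ => (q.1, τ)) q.2 := by fun_prop
    filter_upwards [this.eventually hq1] with τ hτ using hτ.symm
  exact ⟨(hasDerivAt_vertical (hq2.of_le (by norm_num)) (hq3.of_le (by norm_num))).congr_of_eventuallyEq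
    hloc, (hasDerivAt_deriv_vertical (hq2.of_le (by norm_num)) hq3).congr_of_eventuallyEq hloc.deriv⟩

end Charts

/-! ### Second variation of the cost along horizontal geodesics. -/

section Horizontal

variable {n : ℕ} {M M' : Type*}
  [TopologicalSpace M] [ChartedSpace (EuclideanSpace ℝ (Fin n)) M]
  [TopologicalSpace M'] [ChartedSpace (EuclideanSpace ℝ (Fin n)) M']
  {f : M × M' → ℝ} {N : Set (M × M')}

/-- The `j`-th component of the differential of `f (y, ·)` at `b`, in the chart at `b`. -/
def covInr (n : ℕ) {M M' : Type*} [TopologicalSpace M']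
    [ChartedSpace (EuclideanSpace ℝ (Fin n)) M'] (f : M × M' → ℝ) (b : M') (j : Fin n) (y : M) :
    ℝ :=
  deriv (fun τ : ℝ => f (y, (extChartAt (𝓡 n) b).symm
    (extChartAt (𝓡 n) b b + τ • EuclideanSpace.single j 1))) 0

lemma pd_inr_eq_deriv {φ : Coord n → ℝ} {z w : EuclideanSpace ℝ (Fin n)}
    (hφ : DifferentiableAt ℝ φ (z, w)) (j : Fin n) :
    pd (Sum.inr j) φ (z, w) = deriv (fun τ : ℝ => φ (z, w + τ • EuclideanSpace.single j 1)) 0 := by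
  have h1 : HasDerivAt (fun τ : ℝ => ((z, w + τ • EuclideanSpace.single j 1) : Coord n))
      (basisVec (Sum.inr j)) 0 := by
    have h2 : HasDerivAt (fun τ : ℝ => w + τ • EuclideanSpace.single j (1 : ℝ))
        (EuclideanSpace.single j 1) 0 := by
      simpa using ((hasDerivAt_id (0 : ℝ)).smul_const (EuclideanSpace.single j (1 : ℝ))).const_add w
    exact (hasDerivAt_const _ _).prodMk h2
  have h3 : HasFDerivAt φ (fderiv ℝ φ (z, w)) (z, w + (0 : ℝ) • EuclideanSpace.single j (1 : ℝ)) := by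
    simpa using hφ.hasFDerivAt
  exact (h3.comp_hasDerivAt (0 : ℝ) h1).deriv.symm

lemma hasDerivAt_deriv_sum {F : Fin n → ℝ → ℝ} {d v : Fin n → ℝ} {t : ℝ}
    (hF : ∀ j, ContDiffAt ℝ 2 (F j) t) (hd : ∀ j, HasDerivAt (deriv (F j)) (d j) t) :
    HasDerivAt (deriv fun r => ∑ j, F j r * v j) (∑ j, d j * v j) t := by
  have h : deriv (fun r => ∑ j, F j r * v j) =ᶠ[𝓝 t] fun r => ∑ j, deriv (F j) r * v j := by
    filter_upwards [Filter.eventually_all.2 fun j => (hF j).eventually (by simp)] with r hr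
    exact (HasDerivAt.fun_sum fun j _ =>
      ((hr j).differentiableAt (by simp)).hasDerivAt.mul_const (v j)).deriv
  exact (HasDerivAt.fun_sum fun j _ => (hd j).mul_const (v j)).congr_of_eventuallyEq h

/-- The two off-diagonal blocks contribute equally, so the quadratic form is minus the mixed sum. -/
lemma isNull_of_sum_eq_zero {a : M × M'} {p v : Fin n → ℝ}
    (hφ : ContDiffAt ℝ 2 (inCoord (n := n) f a) (toCoord a a))
    (h : ∑ i, (∑ j, pd (Sum.inl i) (pd (Sum.inr j) (inCoord f a)) (toCoord a a) * v j) * p i = 0) :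
    IsNull f a (Sum.elim p v) := by
  have e : costMetric (n := n) f a = potentialMetric (inCoord f a) := rfl
  unfold IsNull
  simp only [e, Fintype.sum_sum_type, Sum.elim_inl, Sum.elim_inr, potentialMetric_inl_inl,
    potentialMetric_inr_inr, potentialMetric_inl_inr, potentialMetric_inr_inl, zero_mul,
    Finset.sum_const_zero, zero_add, add_zero, pd_comm hφ (Sum.inr _) (Sum.inl _)]
  rw [Finset.sum_comm (f := fun j i => -(1 / 2) * pd (Sum.inl i) (pd (Sum.inr j) (inCoord f a))
    (toCoord a a) * v j * p i), ← Finset.sum_add_distrib, ← neg_zero, ← h, ← Finset.sum_neg_distrib]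
  refine Finset.sum_congr rfl fun i _ => ?_
  rw [← Finset.sum_add_distrib, Finset.sum_mul, ← Finset.sum_neg_distrib]
  exact Finset.sum_congr rfl fun j _ => by ring

variable [IsManifold (𝓡 n) ∞ M] [IsManifold (𝓡 n) ∞ M']

/-- `covInr` uses no chart of the first factor. Computations in charts centred at different points
of a horizontal geodesic therefore concern one and the same function of its parameter. -/
lemma eventually_covInr_eq (hN : IsOpen N)
    (hf : ContMDiffOn ((𝓡 n).prod (𝓡 n)) 𝓘(ℝ, ℝ) 4 f N) {y₀ : M} {b : M'} (hp : (y₀, b) ∈ N)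
    (j : Fin n) : ∀ᶠ y in 𝓝 y₀, covInr n f b j y
      = pd (Sum.inr j) (inCoord f (y₀, b)) (toCoord (y₀, b) (y, b)) := by
  have hmap : ContinuousAt (fun y : M => (y, b)) y₀ := by fun_prop
  have hB : ∀ᶠ y in 𝓝 y₀, ContDiffAt ℝ 4 (inCoord (n := n) f (y₀, b)) (toCoord (y₀, b) (y, b)) :=
    (ContinuousAt.comp (f := fun y : M => (y, b)) (x := y₀)
      (g := toCoord (n := n) (y₀, b)) (continuousAt_toCoord _) hmap).eventually
      ((contDiffAt_inCoord hN hf hp).eventually (by simp))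
  filter_upwards [hB, extChartAt_source_mem_nhds (I := 𝓡 n) y₀] with y h1 h2
  rw [toCoord, pd_inr_eq_deriv (h1.differentiableAt (by simp))]
  simp only [inCoord, (extChartAt (𝓡 n) y₀).left_inv h2, covInr]

/-- A geodesic of `N` in the first factor, over the point `b` of the second factor. -/
structure HorizontalGeodesic (n : ℕ) {M M' : Type*}
    [TopologicalSpace M] [ChartedSpace (EuclideanSpace ℝ (Fin n)) M]
    [TopologicalSpace M'] [ChartedSpace (EuclideanSpace ℝ (Fin n)) M']
    (f : M × M' → ℝ) (N : Set (M × M')) (b : M') (X : ℝ → M) : Prop where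
  mem : ∀ s ∈ Icc (0 : ℝ) 1, (X s, b) ∈ N
  continuousOn : ContinuousOn X (Icc 0 1)
  contMDiffAt : ∀ s ∈ Ioo (0 : ℝ) 1, ContMDiffAt 𝓘(ℝ, ℝ) (𝓡 n) 2 X s
  geodesicEqAt : ∀ s ∈ Ioo (0 : ℝ) 1, GeodesicEqAt n f (fun r => (X r, b)) s

variable {b : M'} {X : ℝ → M}

/-- Along a horizontal geodesic, the differential of the cost in the second factor is affine. -/
lemma HorizontalGeodesic.covInr_affine (hX : HorizontalGeodesic n f N b X) (hN : IsOpen N)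
    (hf : ContMDiffOn ((𝓡 n).prod (𝓡 n)) 𝓘(ℝ, ℝ) 4 f N) (hnd : Nondegenerate n f N)
    {s : ℝ} (hs : s ∈ Ioo (0 : ℝ) 1) (j : Fin n) :
    HasDerivAt (deriv fun r => covInr n f b j (X r)) 0 s := by
  have hp := hX.mem s (Ioo_subset_Icc_self hs)
  have hφ := contDiffAt_inCoord hN hf hp
  have hξ := contDiffAt_chart_comp (hX.contMDiffAt s hs) (mem_extChartAt_source (I := 𝓡 n) (X s))
  have hη : ContDiffAt ℝ 2 (fun r => toCoord (n := n) (X s, b) (X r, b)) s :=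
    hξ.prodMk (contDiffAt_const (c := extChartAt (𝓡 n) b b))
  have hgeo := (hX.geodesicEqAt s hs).geodesicAt hη
  have hdη : deriv (fun r => toCoord (n := n) (X s, b) (X r, b)) s
      = (deriv (fun r => extChartAt (𝓡 n) (X s) (X r)) s, 0) :=
    deriv_prodMk_const_right (hξ.differentiableAt (by simp)) (extChartAt (𝓡 n) b b)
  have hddη : deriv (deriv fun r => toCoord (n := n) (X s, b) (X r, b)) s
      = (deriv (deriv fun r => extChartAt (𝓡 n) (X s) (X r)) s, 0) :=
    deriv_deriv_prodMk_const_right hξ (extChartAt (𝓡 n) b b)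
  have h := hgeo.deriv_deriv_pd_inr (hφ.of_le (by norm_num)) hη (isUnit_mixedPd hnd hp)
    (fun j => by rw [hdη]; simp [coordFun]) (fun j => by rw [hddη]; simp [coordFun]) j
  refine h.congr_of_eventuallyEq (Filter.EventuallyEq.deriv ?_)
  exact (hX.contMDiffAt s hs).continuousAt.eventually (eventually_covInr_eq hN hf hp j)

/-- The behaviour of the first two time derivatives of the cost along a curve `β` through `b`
with respect to the parameter of a horizontal geodesic. -/
lemma HorizontalGeodesic.second_variation (hX : HorizontalGeodesic n f N b X) (hN : IsOpen N)
    (hf : ContMDiffOn ((𝓡 n).prod (𝓡 n)) 𝓘(ℝ, ℝ) 4 f N) (hnd : Nondegenerate n f N)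
    {β : ℝ → M'} {t₀ : ℝ} (hβ : ContMDiffAt 𝓘(ℝ, ℝ) (𝓡 n) 2 β t₀) (hb : β t₀ = b)
    {s : ℝ} (hs : s ∈ Ioo (0 : ℝ) 1) :
    let e₁ := fun r => deriv (fun τ => f (X r, β τ)) t₀
    let e₂ := fun r => deriv (deriv fun τ => f (X r, β τ)) t₀
    let v := deriv (fun τ => extChartAt (𝓡 n) b (β τ)) t₀
    let p := deriv (fun r => extChartAt (𝓡 n) (X s) (X r)) s
    ContDiffAt ℝ 2 e₁ s ∧ ContDiffAt ℝ 2 e₂ s ∧ HasDerivAt (deriv e₁) 0 s ∧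
      HasDerivAt (deriv e₂) (-2 * sec (costMetric f (X s, b)) (toCoord (X s, b) (X s, b))
        (Sum.elim p 0) (Sum.elim 0 v)) s ∧
      (deriv e₁ s = 0 → IsNull f (X s, b) (Sum.elim p v)) := by
  intro e₁ e₂ v p
  subst hb
  have hp := hX.mem s (Ioo_subset_Icc_self hs)
  have hφ := contDiffAt_inCoord hN hf hp
  have hξ := contDiffAt_chart_comp (hX.contMDiffAt s hs) (mem_extChartAt_source (I := 𝓡 n) (X s))
  set φ := inCoord (n := n) f (X s, β t₀) with hφdef
  set η : ℝ → Coord n := fun r => toCoord (n := n) (X s, β t₀) (X r, β t₀) with hηdef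
  set a := deriv (deriv fun τ => extChartAt (𝓡 n) (β t₀) (β τ)) t₀ with ha
  have hη : ContDiffAt ℝ 2 η s :=
    hξ.prodMk (contDiffAt_const (c := extChartAt (𝓡 n) (β t₀) (β t₀)))
  have hφη : ContDiffAt ℝ 4 φ (η s) := hφ
  have hu : IsUnit (mixedPd φ (η s)) := isUnit_mixedPd hnd hp
  have hgeo : GeodesicAt φ η s := (hX.geodesicEqAt s hs).geodesicAt hη
  have hdη : deriv η s = (p, 0) := deriv_prodMk_const_right
    (hξ.differentiableAt (by simp)) (extChartAt (𝓡 n) (β t₀) (β t₀))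
  have hddη : deriv (deriv η) s = (deriv (deriv fun r => extChartAt (𝓡 n) (X s) (X r)) s, 0) :=
    deriv_deriv_prodMk_const_right hξ (extChartAt (𝓡 n) (β t₀) (β t₀))
  have hη1 : ∀ j, coordFun (Sum.inr j) (deriv η s) = 0 := fun j => by rw [hdη]; simp [coordFun]
  have hη2 : ∀ j, coordFun (Sum.inr j) (deriv (deriv η) s) = 0 := fun j => by
    rw [hddη]; simp [coordFun]
  have hmap : ContinuousAt (fun r => (X r, t₀)) s :=
    (hX.contMDiffAt s hs).continuousAt.prodMk continuousAt_const
  have hev := hmap.eventually (eventually_hasDerivAt_vertical hN hf hβ hp)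
  have h1 : e₁ =ᶠ[𝓝 s] fun r => velInr φ v (η r) := by
    filter_upwards [hev] with r hr using hr.1.deriv
  have h2 : e₂ =ᶠ[𝓝 s] fun r => accInr φ v a (η r) := by
    filter_upwards [hev] with r hr using hr.2.deriv
  have hpd : ∀ j, ContDiffAt ℝ 2 (fun r => pd (Sum.inr j) φ (η r)) s := fun j =>
    (contDiffAt_pd hφη (m := 2) (by norm_num) _).comp s hη
  have hvel : ∀ w : EuclideanSpace ℝ (Fin n), HasDerivAt (deriv fun r => velInr φ w (η r)) 0 s := by
    intro w
    have := hasDerivAt_deriv_sum (v := w) hpd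
      (hgeo.deriv_deriv_pd_inr (hφη.of_le (by norm_num)) hη hu hη1 hη2)
    simp only [zero_mul, Finset.sum_const_zero] at this
    exact this
  have hvC : ∀ w, ContDiffAt ℝ 2 (fun r => velInr φ w (η r)) s := fun w =>
    (contDiffAt_velInr hφη (m := 2) (by norm_num) w).comp s hη
  have hhC : ContDiffAt ℝ 2 (fun r => hessInr φ v (η r)) s :=
    (contDiffAt_hessInr hφη (m := 2) (by norm_num) v).comp s hη
  refine ⟨(hvC v).congr_of_eventuallyEq h1, (hhC.add (hvC a)).congr_of_eventuallyEq h2,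
    (hvel v).congr_of_eventuallyEq h1.deriv, ?_, fun h0 => ?_⟩
  · have h3 : deriv (fun r => accInr φ v a (η r)) =ᶠ[𝓝 s]
        fun r => deriv (fun r => hessInr φ v (η r)) r + deriv (fun r => velInr φ a (η r)) r := by
      filter_upwards [hhC.eventually (by simp), (hvC a).eventually (by simp)] with r hr1 hr2
      exact deriv_fun_add (hr1.differentiableAt (by simp)) (hr2.differentiableAt (by simp))
    have h4 := hgeo.deriv_deriv_hessInr hφη hη hu hη1 hη2 v
    have h5 := ((h4.add (hvel a)).congr_of_eventuallyEq h3).congr_of_eventuallyEq h2.deriv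
    rw [add_zero, hdη] at h5
    exact h5
  · refine isNull_of_sum_eq_zero (hφ.of_le (by norm_num)) ?_
    have h6 := hasDerivAt_comp_curve
      ((contDiffAt_velInr hφη (m := 2) (by norm_num) v).differentiableAt (by simp))
      (hη.differentiableAt (by simp)).hasDerivAt
    rw [h1.deriv_eq, h6.deriv, hdη] at h0
    simpa [Fintype.sum_sum_type, coordFun, pd_velInr (hφη.of_le (by norm_num))] using h0

/-- The first variation of the acceleration vanishes at the initial point of a horizontal geodesic
issuing from a point of a vertical geodesic. -/
lemma HorizontalGeodesic.tendsto_deriv_acc (hX : HorizontalGeodesic n f N b X) (hN : IsOpen N)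
    (hf : ContMDiffOn ((𝓡 n).prod (𝓡 n)) 𝓘(ℝ, ℝ) 4 f N) (hnd : Nondegenerate n f N)
    {β : ℝ → M'} {t₀ : ℝ} (hβ : ContMDiffAt 𝓘(ℝ, ℝ) (𝓡 n) 2 β t₀) (hb : β t₀ = b)
    (hgeo : GeodesicEqAt n f (fun τ => (X 0, β τ)) t₀) :
    Filter.Tendsto (deriv fun r => deriv (deriv fun τ => f (X r, β τ)) t₀) (𝓝[>] 0) (𝓝 0) := by
  subst hb
  have h01 : (0 : ℝ) ∈ Icc (0 : ℝ) 1 := ⟨le_rfl, zero_le_one⟩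
  have hp := hX.mem 0 h01
  have hφ := contDiffAt_inCoord hN hf hp
  have hu := isUnit_mixedPd hnd hp
  have hζ := contDiffAt_chart_comp hβ (mem_extChartAt_source (I := 𝓡 n) (β t₀))
  set φ := inCoord (n := n) f (X 0, β t₀) with hφdef
  set z₀ : Coord n := toCoord (X 0, β t₀) (X 0, β t₀) with hz₀
  set η : ℝ → Coord n := fun r => toCoord (n := n) (X 0, β t₀) (X r, β t₀) with hηdef
  set v := deriv (fun τ => extChartAt (𝓡 n) (β t₀) (β τ)) t₀ with hv
  set a := deriv (deriv fun τ => extChartAt (𝓡 n) (β t₀) (β τ)) t₀ with ha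
  have hQ0 : ∀ i, pd (Sum.inl i) (accInr φ v a) z₀ = 0 :=
    (hgeo.geodesicAt
      ((contDiffAt_const (c := extChartAt (𝓡 n) (X 0) (X 0))).prodMk hζ)).pd_inl_accInr hφ hζ hu
  have hQ : ContDiffAt ℝ 2 (accInr φ v a) z₀ := contDiffAt_accInr hφ (by norm_num) v a
  -- The velocity of `X` is not known to be bounded near 0. Writing the gradient of the acceleration
  -- as the mixed Hessian times `lam`, its pairing with the velocity becomes `lam` paired with the
  -- derivative of the affine covector `covInr`. That derivative is constant, while `lam` tends to 0
  -- because the gradient vanishes at `z₀`.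
  set lam : Fin n → Coord n → ℝ := fun j z =>
    ∑ i, (mixedPd φ z)⁻¹ j i * pd (Sum.inl i) (accInr φ v a) z with hlam
  have hlam0 : ∀ j, lam j z₀ = 0 := fun j => by simp [hlam, hQ0]
  have hlamc : ∀ j, ContinuousAt (lam j) z₀ := fun j => by
    refine ContDiffAt.continuousAt (n := 1) (𝕜 := ℝ) ?_
    exact ContDiffAt.sum fun i _ => (contDiffAt_inv_apply
      (fun i k => contDiffAt_mixedPd hφ (by norm_num) i k) hu j i).mul
      (contDiffAt_pd hQ (by norm_num) _)
  have hX0 : Filter.Tendsto X (𝓝[>] 0) (𝓝 (X 0)) :=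
    ((hX.continuousOn 0 h01).mono_of_mem_nhdsWithin (Icc_mem_nhdsGT zero_lt_one))
  have hη0 : Filter.Tendsto η (𝓝[>] 0) (𝓝 z₀) := by
    have hmap : ContinuousAt (fun y : M => (y, β t₀)) (X 0) := by fun_prop
    exact (ContinuousAt.comp (f := fun y : M => (y, β t₀)) (x := X 0)
      (g := toCoord (n := n) (X 0, β t₀)) (continuousAt_toCoord _) hmap).tendsto.comp hX0
  -- An arbitrary interior parameter at which to read off the constant derivative of `covInr`.
  have hhalf : (1 / 2 : ℝ) ∈ Ioo (0 : ℝ) 1 := ⟨by norm_num, by norm_num⟩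
  have hlim : Filter.Tendsto
      (fun s => ∑ j, lam j (η s) * deriv (fun r => covInr n f (β t₀) j (X r)) (1 / 2))
      (𝓝[>] 0) (𝓝 0) := by
    have : ∀ j, Filter.Tendsto (fun s => lam j (η s)
        * deriv (fun r => covInr n f (β t₀) j (X r)) (1 / 2)) (𝓝[>] 0) (𝓝 0) := fun j => by
      have h := ((hlamc j).tendsto.comp hη0).mul_const
        (deriv (fun r => covInr n f (β t₀) j (X r)) (1 / 2))
      rwa [hlam0, zero_mul] at h
    simpa using tendsto_finsetSum Finset.univ fun j _ => this j
  refine hlim.congr' ?_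
  have hmap : ContinuousAt (fun y : M => (y, t₀)) (X 0) := by fun_prop
  have e1 := hX0.eventually (eventually_eventually_nhds.2
    (hmap.eventually (eventually_hasDerivAt_vertical hN hf hβ hp)))
  have e2 := hX0.eventually (eventually_eventually_nhds.2
    (Filter.eventually_all.2 (eventually_covInr_eq hN hf hp)))
  have e3 := hη0.eventually (hφ.eventually (by simp))
  have e4 := hη0.eventually (eventually_isUnit_mixedPd (hφ.of_le (by norm_num)) hu)
  have e5 := hX0.eventually (extChartAt_source_mem_nhds (I := 𝓡 n) (X 0))
  have e6 := hη0.eventually (hQ.eventually (by simp))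
  filter_upwards [e1, e2, e3, e4, e5, e6, Ioo_mem_nhdsGT zero_lt_one] with s h1 h2 h3 h4 h5 h6 hs
  have hXs := hX.contMDiffAt s hs
  have hξ := contDiffAt_chart_comp hXs h5
  have hη : HasDerivAt η (deriv (fun r => extChartAt (𝓡 n) (X 0) (X r)) s, 0) s :=
    (hξ.differentiableAt (by simp)).hasDerivAt.prodMk
      (hasDerivAt_const s (extChartAt (𝓡 n) (β t₀) (β t₀)))
  set x' := deriv (fun r => extChartAt (𝓡 n) (X 0) (X r)) s with hx'
  have hcov : ∀ j, deriv (fun r => covInr n f (β t₀) j (X r)) (1 / 2)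
      = ∑ i, pd (Sum.inl i) (pd (Sum.inr j) φ) (η s) * x' i := fun j => by
    rw [deriv_eq_of_hasDerivAt_deriv_zero (g := deriv fun r => covInr n f (β t₀) j (X r))
      (fun r hr => hX.covInr_affine hN hf hnd hr j) hhalf hs]
    have hloc : (fun r => covInr n f (β t₀) j (X r)) =ᶠ[𝓝 s] fun r => pd (Sum.inr j) φ (η r) := by
      filter_upwards [hXs.continuousAt.eventually h2] with r hr using hr j
    have h := hasDerivAt_comp_curve
      ((contDiffAt_pd h3 (m := 3) (by norm_num) (Sum.inr j)).differentiableAt (by simp)) hη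
    rw [hloc.deriv_eq, h.deriv]
    simp [Fintype.sum_sum_type, coordFun]
  have hacc : deriv (fun r => deriv (deriv fun τ => f (X r, β τ)) t₀) s
      = ∑ i, pd (Sum.inl i) (accInr φ v a) (η s) * x' i := by
    have hloc : (fun r => deriv (deriv fun τ => f (X r, β τ)) t₀) =ᶠ[𝓝 s]
        fun r => accInr φ v a (η r) := by
      filter_upwards [hXs.continuousAt.eventually h1] with r hr using hr.2.deriv
    have h := hasDerivAt_comp_curve (h6.differentiableAt (by simp)) hη
    rw [hloc.deriv_eq, h.deriv]
    simp [Fintype.sum_sum_type, coordFun]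
  rw [hacc]
  have hgrad : ∀ i, pd (Sum.inl i) (accInr φ v a) (η s)
      = ∑ j, pd (Sum.inl i) (pd (Sum.inr j) φ) (η s) * lam j (η s) := by
    have : (mixedPd φ (η s)).mulVec ((mixedPd φ (η s))⁻¹.mulVec
        fun i => pd (Sum.inl i) (accInr φ v a) (η s))
        = fun i => pd (Sum.inl i) (accInr φ v a) (η s) := by
      rw [Matrix.mulVec_mulVec,
        Matrix.mul_nonsing_inv _ ((Matrix.isUnit_iff_isUnit_det _).1 h4), Matrix.one_mulVec]
    intro i
    refine (congrFun this i).symm.trans ?_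
    change ∑ j, mixedPd φ (η s) i j * lam j (η s) = _
    refine Finset.sum_congr rfl fun j _ => ?_
    rw [pd_comm (h3.of_le (by norm_num)) (Sum.inl i)]
    rfl
  simp only [hcov, hgrad, Finset.mul_sum, Finset.sum_mul]
  rw [Finset.sum_comm]
  exact Finset.sum_congr rfl fun i _ => Finset.sum_congr rfl fun j _ => by ring

/-- The time derivatives depend continuously on the point of the first factor, so continuity of `X`
alone carries them to the endpoints `s = 0, 1`. -/
lemma continuousOn_vertical_derivs (hX : HorizontalGeodesic n f N b X) (hN : IsOpen N)
    (hf : ContMDiffOn ((𝓡 n).prod (𝓡 n)) 𝓘(ℝ, ℝ) 4 f N)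
    {β : ℝ → M'} {t₀ : ℝ} (hβ : ContMDiffAt 𝓘(ℝ, ℝ) (𝓡 n) 2 β t₀) (hb : β t₀ = b) :
    ContinuousOn (fun r => deriv (fun τ => f (X r, β τ)) t₀) (Icc 0 1) ∧
      ContinuousOn (fun r => deriv (deriv fun τ => f (X r, β τ)) t₀) (Icc 0 1) := by
  subst hb
  have key : ∀ s ∈ Icc (0 : ℝ) 1, ContinuousAt (fun y => deriv (fun τ => f (y, β τ)) t₀) (X s) ∧
      ContinuousAt (fun y => deriv (deriv fun τ => f (y, β τ)) t₀) (X s) := by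
    intro s hs
    have hp := hX.mem s hs
    have hφ := contDiffAt_inCoord hN hf hp
    have hmap : ContinuousAt (fun y : M => (y, t₀)) (X s) := by fun_prop
    have e1 := hmap.eventually (eventually_hasDerivAt_vertical hN hf hβ hp)
    have hmap' : ContinuousAt (fun y : M => toCoord (n := n) (X s, β t₀) (y, β t₀)) (X s) :=
      ContinuousAt.comp (f := fun y : M => (y, β t₀)) (x := X s)
        (g := toCoord (n := n) (X s, β t₀)) (continuousAt_toCoord _) (by fun_prop)
    refine ⟨ContinuousAt.congr (ContinuousAt.comp (x := X s) (contDiffAt_velInr hφ (m := 3)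
      (by norm_num) (deriv (fun τ => extChartAt (𝓡 n) (β t₀) (β τ)) t₀)).continuousAt hmap') ?_,
      ContinuousAt.congr (ContinuousAt.comp (x := X s) (contDiffAt_accInr hφ (m := 2)
      (by norm_num) (deriv (fun τ => extChartAt (𝓡 n) (β t₀) (β τ)) t₀)
      (deriv (deriv fun τ => extChartAt (𝓡 n) (β t₀) (β τ)) t₀)).continuousAt hmap') ?_⟩
    · filter_upwards [e1] with y hy using hy.1.deriv.symm
    · filter_upwards [e1] with y hy using hy.2.deriv.symm
  exact ⟨fun s hs => (key s hs).1.comp_continuousWithinAt (hX.continuousOn s hs),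
    fun s hs => (key s hs).2.comp_continuousWithinAt (hX.continuousOn s hs)⟩

/-- At a common critical time, the acceleration of the cost along a vertical geodesic through
`X 0` does not increase along a horizontal geodesic. -/
lemma HorizontalGeodesic.acc_le (hX : HorizontalGeodesic n f N b X) (hN : IsOpen N)
    (hf : ContMDiffOn ((𝓡 n).prod (𝓡 n)) 𝓘(ℝ, ℝ) 4 f N) (hreg : WeaklyRegular n f N)
    {β : ℝ → M'} {t₀ : ℝ} (hβ : ContMDiffAt 𝓘(ℝ, ℝ) (𝓡 n) 2 β t₀) (hb : β t₀ = b)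
    (hgeo : GeodesicEqAt n f (fun τ => (X 0, β τ)) t₀)
    (heq : deriv (fun τ => f (X 0, β τ)) t₀ = deriv (fun τ => f (X 1, β τ)) t₀) :
    deriv (deriv fun τ => f (X 1, β τ)) t₀ ≤ deriv (deriv fun τ => f (X 0, β τ)) t₀ := by
  have hc := continuousOn_vertical_derivs hX hN hf hβ hb
  have hvar := fun s hs => hX.second_variation hN hf hreg.1 hβ hb (s := s) hs
  -- Equal end values of the affine first variation make it constant; this is the nullity that weak
  -- regularity requires.
  have hzero : ∀ s ∈ Ioo (0 : ℝ) 1, deriv (fun r => deriv (fun τ => f (X r, β τ)) t₀) s = 0 :=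
    fun s hs => deriv_eq_zero_of_affine hc.1
      (fun s hs => ((hvar s hs).1.differentiableAt (by simp)).hasDerivAt)
      (fun s hs => (hvar s hs).2.2.1) heq hs
  refine le_of_concave_of_deriv_tendsto_zero hc.2
    (fun s hs => ((hvar s hs).2.1.differentiableAt (by simp)).hasDerivAt)
    (fun s hs => (hvar s hs).2.2.2.1) (fun s hs => ?_)
    (hX.tendsto_deriv_acc hN hf hreg.1 hβ hb hgeo)
  have hnull := (hvar s hs).2.2.2.2 (hzero s hs)
  have := hreg.2 _ (hX.mem s (Ioo_subset_Icc_self hs)) _ _ hnull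
  linarith

end Horizontal

/-! ### The differential inequality and the maximum principle along a vertical geodesic. -/

section VerticalGeodesics

variable {n : ℕ} {M M' : Type*}
  [TopologicalSpace M] [ChartedSpace (EuclideanSpace ℝ (Fin n)) M]
  [TopologicalSpace M'] [ChartedSpace (EuclideanSpace ℝ (Fin n)) M']
  {f : M × M' → ℝ} {N : Set (M × M')}

/-- The `i`-th component of the differential of `f (·, b)` at `x`, in the chart at `x`. -/
def covInl (n : ℕ) {M M' : Type*} [TopologicalSpace M]
    [ChartedSpace (EuclideanSpace ℝ (Fin n)) M] (f : M × M' → ℝ) (x : M) (i : Fin n) (b : M') :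
    ℝ :=
  deriv (fun r : ℝ => f ((extChartAt (𝓡 n) x).symm
    (extChartAt (𝓡 n) x x + r • EuclideanSpace.single i 1), b)) 0

lemma hasDerivAt_line {F : Coord n → ℝ} {z w : EuclideanSpace ℝ (Fin n)} {i : Fin n} {r : ℝ}
    (hF : DifferentiableAt ℝ F (z + r • EuclideanSpace.single i 1, w)) :
    HasDerivAt (fun ρ : ℝ => F (z + ρ • EuclideanSpace.single i 1, w))
      (pd (Sum.inl i) F (z + r • EuclideanSpace.single i 1, w)) r := by
  have h2 : HasDerivAt (fun ρ : ℝ => z + ρ • EuclideanSpace.single i (1 : ℝ))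
      (EuclideanSpace.single i 1) r := by
    simpa using ((hasDerivAt_id r).smul_const (EuclideanSpace.single i (1 : ℝ))).const_add z
  have h1 : HasDerivAt (fun ρ : ℝ => ((z + ρ • EuclideanSpace.single i 1, w) : Coord n))
      (basisVec (Sum.inl i)) r := h2.prodMk (hasDerivAt_const _ _)
  exact hF.hasFDerivAt.comp_hasDerivAt r h1

/-- A geodesic of `N` in the second factor, over the point `x` of the first factor. -/
structure VerticalGeodesic (n : ℕ) {M M' : Type*}
    [TopologicalSpace M] [ChartedSpace (EuclideanSpace ℝ (Fin n)) M]
    [TopologicalSpace M'] [ChartedSpace (EuclideanSpace ℝ (Fin n)) M']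
    (f : M × M' → ℝ) (N : Set (M × M')) (x : M) (β : ℝ → M') : Prop where
  mem : ∀ t ∈ Ioo (0 : ℝ) 1, (x, β t) ∈ N
  contMDiffAt : ∀ t ∈ Ioo (0 : ℝ) 1, ContMDiffAt 𝓘(ℝ, ℝ) (𝓡 n) 2 β t
  geodesicEqAt : ∀ t ∈ Ioo (0 : ℝ) 1, GeodesicEqAt n f (fun τ => (x, β τ)) t

variable [IsManifold (𝓡 n) ∞ M] [IsManifold (𝓡 n) ∞ M']

lemma eventually_covInl_eq (hN : IsOpen N)
    (hf : ContMDiffOn ((𝓡 n).prod (𝓡 n)) 𝓘(ℝ, ℝ) 4 f N) {x : M} {b₀ : M'} (hp : (x, b₀) ∈ N)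
    (i : Fin n) : ∀ᶠ b in 𝓝 b₀, covInl n f x i b
      = pd (Sum.inl i) (inCoord f (x, b₀)) (toCoord (x, b₀) (x, b)) := by
  have hmap : ContinuousAt (fun b : M' => (x, b)) b₀ := by fun_prop
  have hB : ∀ᶠ b in 𝓝 b₀, ContDiffAt ℝ 4 (inCoord (n := n) f (x, b₀)) (toCoord (x, b₀) (x, b)) :=
    (ContinuousAt.comp (f := fun b : M' => (x, b)) (x := b₀)
      (g := toCoord (n := n) (x, b₀)) (continuousAt_toCoord _) hmap).eventually
      ((contDiffAt_inCoord hN hf hp).eventually (by simp))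
  filter_upwards [hB, extChartAt_source_mem_nhds (I := 𝓡 n) b₀] with b h1 h2
  have h3 := hasDerivAt_line (F := inCoord (n := n) f (x, b₀)) (z := extChartAt (𝓡 n) x x)
    (w := extChartAt (𝓡 n) b₀ b) (i := i) (r := 0)
    (by simpa [toCoord] using h1.differentiableAt (by simp))
  rw [zero_smul, add_zero] at h3
  rw [toCoord, ← h3.deriv]
  simp only [inCoord, (extChartAt (𝓡 n) b₀).left_inv h2, covInl]

variable {x : M} {β : ℝ → M'}

lemma VerticalGeodesic.hasDerivAt_covInl (hβ : VerticalGeodesic n f N x β) (hN : IsOpen N)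
    (hf : ContMDiffOn ((𝓡 n).prod (𝓡 n)) 𝓘(ℝ, ℝ) 4 f N) (hnd : Nondegenerate n f N)
    {t : ℝ} (ht : t ∈ Ioo (0 : ℝ) 1) (i : Fin n) :
    HasDerivAt (fun r => covInl n f x i (β r))
      (∑ j, pd (Sum.inr j) (pd (Sum.inl i) (inCoord f (x, β t))) (toCoord (x, β t) (x, β t))
        * deriv (fun τ => extChartAt (𝓡 n) (β t) (β τ)) t j) t ∧
      HasDerivAt (deriv fun r => covInl n f x i (β r)) 0 t := by
  have hp := hβ.mem t ht
  have hφ := contDiffAt_inCoord hN hf hp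
  have hζ := contDiffAt_chart_comp (hβ.contMDiffAt t ht) (mem_extChartAt_source (I := 𝓡 n) (β t))
  have hη : ContDiffAt ℝ 2 (fun τ => toCoord (n := n) (x, β t) (x, β τ)) t :=
    (contDiffAt_const (c := extChartAt (𝓡 n) x x)).prodMk hζ
  have hgeo := (hβ.geodesicEqAt t ht).geodesicAt hη
  have hdη : deriv (fun τ => toCoord (n := n) (x, β t) (x, β τ)) t
      = (0, deriv (fun τ => extChartAt (𝓡 n) (β t) (β τ)) t) :=
    deriv_prodMk_const_left (hζ.differentiableAt (by simp)) (extChartAt (𝓡 n) x x)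
  have hddη : deriv (deriv fun τ => toCoord (n := n) (x, β t) (x, β τ)) t
      = (0, deriv (deriv fun τ => extChartAt (𝓡 n) (β t) (β τ)) t) :=
    deriv_deriv_prodMk_const_left hζ (extChartAt (𝓡 n) x x)
  have hloc : (fun r => covInl n f x i (β r)) =ᶠ[𝓝 t]
      fun r => pd (Sum.inl i) (inCoord f (x, β t)) (toCoord (x, β t) (x, β r)) :=
    (hβ.contMDiffAt t ht).continuousAt.eventually (eventually_covInl_eq hN hf hp i)
  have h := hgeo.deriv_deriv_pd_inl (hφ.of_le (by norm_num)) hη (isUnit_mixedPd hnd hp)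
    (fun j => by rw [hdη]; simp [coordFun]) (fun j => by rw [hddη]; simp [coordFun]) i
  refine ⟨?_, h.congr_of_eventuallyEq hloc.deriv⟩
  have h1 := hasDerivAt_comp_curve (F := pd (Sum.inl i) (inCoord f (x, β t)))
    (η := fun τ => toCoord (n := n) (x, β t) (x, β τ)) (t := t)
    ((contDiffAt_pd hφ (m := 3) (by norm_num) _).differentiableAt (by simp))
    (hη.differentiableAt (by simp)).hasDerivAt
  rw [hdη] at h1
  simp only [Fintype.sum_sum_type, coordFun, PiLp.zero_apply, mul_zero, Finset.sum_const_zero,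
    zero_add] at h1
  exact h1.congr_of_eventuallyEq hloc

/-- A vertical geodesic which is stationary at one time is stationary at all times. -/
lemma VerticalGeodesic.velocity_eq_zero (hβ : VerticalGeodesic n f N x β) (hN : IsOpen N)
    (hf : ContMDiffOn ((𝓡 n).prod (𝓡 n)) 𝓘(ℝ, ℝ) 4 f N) (hnd : Nondegenerate n f N)
    {t₀ t : ℝ} (ht₀ : t₀ ∈ Ioo (0 : ℝ) 1) (ht : t ∈ Ioo (0 : ℝ) 1)
    (h0 : deriv (fun τ => extChartAt (𝓡 n) (β t₀) (β τ)) t₀ = 0) :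
    deriv (fun τ => extChartAt (𝓡 n) (β t) (β τ)) t = 0 := by
  -- The covector `covInl` is affine in time. Its constant derivative is the mixed Hessian applied
  -- to the velocity, so it vanishes at all times once it vanishes at `t₀`, and non-degeneracy
  -- recovers the velocity.
  have hcov : ∀ i, deriv (fun r => covInl n f x i (β r)) t = 0 := fun i => by
    rw [deriv_eq_of_hasDerivAt_deriv_zero (g := deriv fun r => covInl n f x i (β r))
      (fun r hr => (hβ.hasDerivAt_covInl hN hf hnd hr i).2) ht ht₀,
      (hβ.hasDerivAt_covInl hN hf hnd ht₀ i).1.deriv, h0]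
    simp
  set v := deriv (fun τ => extChartAt (𝓡 n) (β t) (β τ)) t with hv
  have hmul : (mixedPd (n := n) (inCoord f (x, β t)) (toCoord (x, β t) (x, β t))).mulVec v
      = Matrix.mulVec (mixedPd (inCoord f (x, β t)) (toCoord (x, β t) (x, β t))) 0 := by
    ext i
    rw [Matrix.mulVec_zero, Pi.zero_apply, ← hcov i,
      (hβ.hasDerivAt_covInl hN hf hnd ht i).1.deriv]
    rfl
  have := Matrix.mulVec_injective_iff_isUnit.2 (isUnit_mixedPd hnd (hβ.mem t ht)) hmul
  ext i
  exact congrFun this i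

lemma hasDerivAt_along_curve (hN : IsOpen N)
    (hf : ContMDiffOn ((𝓡 n).prod (𝓡 n)) 𝓘(ℝ, ℝ) 4 f N) {t : ℝ}
    (hβ : ContMDiffAt 𝓘(ℝ, ℝ) (𝓡 n) 2 β t) {y : M} (hp : (y, β t) ∈ N) :
    HasDerivAt (fun τ => f (y, β τ)) (deriv (fun τ => f (y, β τ)) t) t ∧
      HasDerivAt (deriv fun τ => f (y, β τ)) (deriv (deriv fun τ => f (y, β τ)) t) t := by
  have h := (eventually_hasDerivAt_vertical hN hf hβ hp).self_of_nhds
  exact ⟨h.1.differentiableAt.hasDerivAt, h.2.differentiableAt.hasDerivAt⟩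

/-- The key differential inequality for the difference of two mountains. -/
lemma VerticalGeodesic.deriv_deriv_sub_le (hβ : VerticalGeodesic n f N x β) (hN : IsOpen N)
    (hf : ContMDiffOn ((𝓡 n).prod (𝓡 n)) 𝓘(ℝ, ℝ) 4 f N) (hreg : WeaklyRegular n f N)
    (hhor : ∀ b y₀ y₁, (y₀, b) ∈ N → (y₁, b) ∈ N → y₀ ≠ y₁ →
      ∃ X, HorizontalGeodesic n f N b X ∧ X 0 = y₀ ∧ X 1 = y₁)
    {y : M} {t₀ : ℝ} (ht₀ : t₀ ∈ Ioo (0 : ℝ) 1) (hp : (y, β t₀) ∈ N)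
    (hcrit : deriv (fun τ => f (y, β τ)) t₀ - deriv (fun τ => f (x, β τ)) t₀ = 0) :
    ∃ C, ∀ᶠ t in 𝓝 t₀,
      deriv (deriv fun τ => f (y, β τ)) t - deriv (deriv fun τ => f (x, β τ)) t
        ≤ C * |deriv (fun τ => f (y, β τ)) t - deriv (fun τ => f (x, β τ)) t| := by
  have hβ₀ := hβ.contMDiffAt t₀ ht₀
  have hIoo : ∀ᶠ t in 𝓝 t₀, t ∈ Ioo (0 : ℝ) 1 := Ioo_mem_nhds ht₀.1 ht₀.2
  have hNy : ∀ᶠ t in 𝓝 t₀, (y, β t) ∈ N :=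
    (continuousAt_const.prodMk hβ₀.continuousAt).eventually (hN.mem_nhds hp)
  set v := deriv (fun τ => extChartAt (𝓡 n) (β t₀) (β τ)) t₀ with hv
  -- If the geodesic is stationary, all time derivatives vanish near `t₀` and `C = 0` works.
  -- Otherwise `v ≠ 0` gives a direction in which to perturb `y`.
  by_cases hv0 : v = 0
  · have hder : ∀ z : M, ∀ t ∈ Ioo (0 : ℝ) 1, (z, β t) ∈ N →
        deriv (fun τ => f (z, β τ)) t = 0 := by
      intro z t ht hz
      have h := (eventually_hasDerivAt_vertical hN hf (hβ.contMDiffAt t ht) hz).self_of_nhds.1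
      rw [h.deriv, hβ.velocity_eq_zero hN hf hreg.1 ht₀ ht hv0]
      simp [velInr]
    refine ⟨0, ?_⟩
    have hy : ∀ᶠ t in 𝓝 t₀, deriv (fun τ => f (y, β τ)) t = 0 := by
      filter_upwards [hIoo, hNy] with t ht h1 using hder y t ht h1
    have hx : ∀ᶠ t in 𝓝 t₀, deriv (fun τ => f (x, β τ)) t = 0 := by
      filter_upwards [hIoo] with t ht using hder x t ht (hβ.mem t ht)
    filter_upwards [hy.eventually_nhds, hx.eventually_nhds] with t h1 h2
    have e1 : deriv (deriv fun τ => f (y, β τ)) t = 0 := by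
      rw [Filter.EventuallyEq.deriv_eq (f := fun _ => (0 : ℝ)) h1, deriv_const]
    have e2 : deriv (deriv fun τ => f (x, β τ)) t = 0 := by
      rw [Filter.EventuallyEq.deriv_eq (f := fun _ => (0 : ℝ)) h2, deriv_const]
    simp [e1, e2]
  have hφ := contDiffAt_inCoord hN hf hp
  have hu := isUnit_mixedPd hreg.1 hp
  have hζ := contDiffAt_chart_comp hβ₀ (mem_extChartAt_source (I := 𝓡 n) (β t₀))
  set φ := inCoord (n := n) f (y, β t₀) with hφdef
  set ζ := fun τ => extChartAt (𝓡 n) (β t₀) (β τ) with hζdef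
  set z₀ := extChartAt (𝓡 n) y y with hz₀
  have hφ' : ContDiffAt ℝ 4 φ (z₀, ζ t₀) := hφ
  have hHv : (mixedPd φ (z₀, ζ t₀)).mulVec v ≠ 0 := by
    intro h
    refine hv0 ?_
    have := Matrix.mulVec_injective_iff_isUnit.2 hu (h.trans (Matrix.mulVec_zero _).symm)
    ext i
    exact congrFun this i
  -- Moving `y` along the coordinate line `i` changes the first time derivative of the cost at
  -- nonzero speed.
  obtain ⟨i, hi⟩ := Function.ne_iff.1 hHv
  rw [Pi.zero_apply] at hi
  set z : ℝ → EuclideanSpace ℝ (Fin n) := fun r => z₀ + r • EuclideanSpace.single i 1 with hz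
  have hz00 : z 0 = z₀ := by simp [hz]
  have hzc : Continuous z := by fun_prop
  have hζc : ContinuousAt ζ t₀ := hζ.continuousAt
  have hζ1 : ContinuousAt (deriv ζ) t₀ := (hasDerivAt_deriv hζ).continuousAt
  have hζ2 : ContinuousAt (deriv (deriv ζ)) t₀ :=
    (contDiffAt_deriv (m := 0) (contDiffAt_deriv (m := 1) hζ (by norm_num))
      (by norm_num)).continuousAt
  have hsnd : ContinuousAt (Prod.snd : ℝ × ℝ → ℝ) (0, t₀) := continuousAt_snd
  have hpt : ContinuousAt (fun q : ℝ × ℝ => (z q.1, ζ q.2)) (0, t₀) :=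
    (hzc.continuousAt.comp continuousAt_fst).prodMk (ContinuousAt.comp (g := ζ) hζc hsnd)
  have hpt0 : (fun q : ℝ × ℝ => (z q.1, ζ q.2)) (0, t₀) = (z₀, ζ t₀) := by simp [hz00]
  have hev4 : ∀ᶠ q : ℝ × ℝ in 𝓝 (0, t₀), ContDiffAt ℝ 4 φ (z q.1, ζ q.2) :=
    hpt.eventually (by rw [hpt0]; exact hφ'.eventually (by simp))
  have hcomp : ∀ F : Coord n → ℝ, ContinuousAt F (z₀, ζ t₀) →
      ContinuousAt (fun q : ℝ × ℝ => F (z q.1, ζ q.2)) (0, t₀) := fun F hF =>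
    ContinuousAt.comp (g := F) (f := fun q : ℝ × ℝ => (z q.1, ζ q.2))
      (by simpa only [hz00] using hF) hpt
  have hpdc2 : ∀ I J, ContinuousAt (pd I (pd J φ)) (z₀, ζ t₀) := fun I J =>
    (contDiffAt_pd_pd hφ' (m := 2) (by norm_num) I J).continuousAt
  have hpdc3 : ∀ I J K, ContinuousAt (pd I (pd J (pd K φ))) (z₀, ζ t₀) := fun I J K =>
    (contDiffAt_pd_pd (contDiffAt_pd hφ' (m := 3) (by norm_num) K) (m := 1) (by norm_num)
      I J).continuousAt
  have hc1 : ∀ j, ContinuousAt (fun q : ℝ × ℝ => deriv ζ q.2 j) (0, t₀) := fun j =>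
    ContinuousAt.comp (g := fun t => deriv ζ t j) (f := Prod.snd)
      ((EuclideanSpace.proj (𝕜 := ℝ) j).continuous.continuousAt.comp hζ1) hsnd
  have hc2 : ∀ j, ContinuousAt (fun q : ℝ × ℝ => deriv (deriv ζ) q.2 j) (0, t₀) := fun j =>
    ContinuousAt.comp (g := fun t => deriv (deriv ζ) t j) (f := Prod.snd)
      ((EuclideanSpace.proj (𝕜 := ℝ) j).continuous.continuousAt.comp hζ2) hsnd
  set yr : ℝ → M := fun r => (extChartAt (𝓡 n) y).symm (z r) with hyr
  have hyr0 : yr 0 = y := by simp [hyr, hz00, hz₀]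
  have hyrc : ContinuousAt yr 0 := by
    refine ContinuousAt.comp (g := (extChartAt (𝓡 n) y).symm) ?_ hzc.continuousAt
    rw [hz00]
    exact continuousAt_extChartAt_symm y
  have hyrq : ContinuousAt (fun q : ℝ × ℝ => yr q.1) (0, t₀) :=
    ContinuousAt.comp (g := yr) (f := Prod.fst) (x := ((0 : ℝ), t₀)) hyrc continuousAt_fst
  have hmap : ContinuousAt (fun q : ℝ × ℝ => (yr q.1, q.2)) (0, t₀) :=
    hyrq.prodMk continuousAt_snd
  have hchart : ∀ᶠ r in 𝓝 (0 : ℝ), extChartAt (𝓡 n) y (yr r) = z r := by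
    have : ∀ᶠ r in 𝓝 (0 : ℝ), z r ∈ (extChartAt (𝓡 n) y).target :=
      hzc.continuousAt.eventually (by rw [hz00]; exact extChartAt_target_mem_nhds y)
    filter_upwards [this] with r hr using (extChartAt (𝓡 n) y).right_inv hr
  have hformula : ∀ᶠ q : ℝ × ℝ in 𝓝 (0, t₀),
      deriv (fun τ => f (yr q.1, β τ)) q.2 = velInr φ (deriv ζ q.2) (z q.1, ζ q.2) ∧
      deriv (deriv fun τ => f (yr q.1, β τ)) q.2
        = accInr φ (deriv ζ q.2) (deriv (deriv ζ) q.2) (z q.1, ζ q.2) := by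
    have h1 := hmap.eventually (by
      simp only [hyr0]; exact eventually_hasDerivAt_vertical hN hf hβ₀ hp)
    filter_upwards [h1, continuousAt_fst.eventually hchart] with q hq hq2
    rw [hq2] at hq
    exact ⟨hq.1.deriv, hq.2.deriv⟩
  have hNq : ∀ᶠ q : ℝ × ℝ in 𝓝 (0, t₀), (yr q.1, β q.2) ∈ N := by
    have : ContinuousAt (fun q : ℝ × ℝ => (yr q.1, β q.2)) (0, t₀) :=
      hyrq.prodMk
        (ContinuousAt.comp (g := β) hβ₀.continuousAt hsnd)
    exact this.eventually (hN.mem_nhds (by simpa only [hyr0] using hp))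
  have hxd := hasDerivAt_along_curve hN hf hβ₀ (hβ.mem t₀ ht₀)
  have hline : ∀ᶠ t in 𝓝 t₀,
      deriv (fun τ => f (y, β τ)) t = velInr φ (deriv ζ t) (z 0, ζ t) ∧
      deriv (deriv fun τ => f (y, β τ)) t
        = accInr φ (deriv ζ t) (deriv (deriv ζ) t) (z 0, ζ t) := by
    have hin : ContinuousAt (fun t : ℝ => ((0 : ℝ), t)) t₀ := by fun_prop
    have := hin.eventually hformula
    simpa only [hyr0] using this
  -- `P` and `Q` are the first and second time derivatives of the difference of costs at `yr r` and
  -- `x`, written in coordinates; `dP` and `dQ` are their derivatives in `r`.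
  refine Exists.imp (fun C hC => ?_) (le_mul_abs_of_zero_imp (t₀ := t₀)
    (P := fun r t => velInr φ (deriv ζ t) (z r, ζ t) - deriv (fun τ => f (x, β τ)) t)
    (Q := fun r t => accInr φ (deriv ζ t) (deriv (deriv ζ) t) (z r, ζ t)
      - deriv (deriv fun τ => f (x, β τ)) t)
    (dP := fun r t => ∑ j, pd (Sum.inl i) (pd (Sum.inr j) φ) (z r, ζ t) * deriv ζ t j)
    (dQ := fun r t => (∑ j, ∑ l, pd (Sum.inl i) (pd (Sum.inr j) (pd (Sum.inr l) φ)) (z r, ζ t)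
      * deriv ζ t j * deriv ζ t l)
      + ∑ j, pd (Sum.inl i) (pd (Sum.inr j) φ) (z r, ζ t) * deriv (deriv ζ) t j)
    ?_ ?_ ?_ ?_ ?_ ?_ ?_ ?_)
  · filter_upwards [hC, hline] with t h1 h2
    rwa [h2.1, h2.2]
  · filter_upwards [hev4] with q hq
    rw [← pd_velInr (hq.of_le (by norm_num))]
    exact (hasDerivAt_line ((contDiffAt_velInr hq (m := 3) (by norm_num) _).differentiableAt
      (by simp))).sub_const _
  · filter_upwards [hev4] with q hq
    rw [← pd_velInr (hq.of_le (by norm_num)), ← pd_hessInr (hq.of_le (by norm_num))]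
    exact ((hasDerivAt_line ((contDiffAt_hessInr hq (m := 2) (by norm_num) _).differentiableAt
      (by simp))).add (hasDerivAt_line ((contDiffAt_velInr hq (m := 3)
      (by norm_num) _).differentiableAt (by simp)))).sub_const _
  · exact tendsto_finsetSum _ fun j _ => (hcomp _ (hpdc2 _ _)).mul (hc1 j)
  · exact (tendsto_finsetSum _ fun j _ => tendsto_finsetSum _ fun l _ =>
      ((hcomp _ (hpdc3 _ _ _)).mul (hc1 j)).mul (hc1 l)).add
      (tendsto_finsetSum _ fun j _ => (hcomp _ (hpdc2 _ _)).mul (hc2 j))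
  · rw [hz00]
    convert hi using 1
    refine Finset.sum_congr rfl fun j _ => ?_
    rw [pd_comm (hφ'.of_le (by norm_num)) (Sum.inl i)]
    rfl
  · refine ContinuousAt.sub ?_ hxd.2.continuousAt
    have hyd := hasDerivAt_along_curve hN hf hβ₀ hp
    exact hyd.2.continuousAt.congr (hline.mono fun t ht => ht.1)
  · rwa [hline.self_of_nhds.1] at hcrit
  · filter_upwards [hformula, hNq, hsnd.eventually hIoo] with q hq hqN hqI h0
    rw [← hq.1] at h0
    rw [← hq.2]
    -- Horizontal convexity joins distinct points only; for equal points the difference is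
    -- identically zero.
    by_cases hxy : x = yr q.1
    · rw [← hxy, sub_self]
    · obtain ⟨X, hX, hX0, hX1⟩ := hhor (β q.2) x (yr q.1) (hβ.mem _ hqI) hqN hxy
      have := hX.acc_le hN hf hreg (hβ.contMDiffAt _ hqI) rfl
        (by rw [hX0]; exact hβ.geodesicEqAt _ hqI) (by rw [hX0, hX1]; linarith)
      rw [hX0, hX1] at this
      linarith

/-- The double mountain stays above the sliding mountain. -/
lemma VerticalGeodesic.min_le (hβ : VerticalGeodesic n f N x β) (hN : IsOpen N)
    (hf : ContMDiffOn ((𝓡 n).prod (𝓡 n)) 𝓘(ℝ, ℝ) 4 f N) (hreg : WeaklyRegular n f N)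
    (hhor : ∀ b y₀ y₁, (y₀, b) ∈ N → (y₁, b) ∈ N → y₀ ≠ y₁ →
      ∃ X, HorizontalGeodesic n f N b X ∧ X 0 = y₀ ∧ X 1 = y₁)
    {y : M} {a d : ℝ} (ha : 0 < a) (hd : d < 1) (hy : ∀ t ∈ Icc a d, (y, β t) ∈ N)
    {t : ℝ} (ht : t ∈ Icc a d) :
    min (f (y, β a) - f (x, β a)) (f (y, β d) - f (x, β d)) ≤ f (y, β t) - f (x, β t) := by
  have hsub : ∀ s ∈ Icc a d, s ∈ Ioo (0 : ℝ) 1 := fun s hs =>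
    ⟨ha.trans_le hs.1, hs.2.trans_lt hd⟩
  have hder : ∀ s ∈ Icc a d, _ := fun s hs =>
    hasDerivAt_along_curve hN hf (hβ.contMDiffAt s (hsub s hs)) (hy s hs)
  have hder' : ∀ s ∈ Icc a d, _ := fun s hs =>
    hasDerivAt_along_curve hN hf (hβ.contMDiffAt s (hsub s hs)) (hβ.mem s (hsub s hs))
  exact min_le_of_deriv_deriv_le (k := fun t => f (y, β t) - f (x, β t))
    (fun s hs => (hder s hs).1.sub (hder' s hs).1)
    (fun s hs => (hder s (Ioo_subset_Icc_self hs)).2.sub (hder' s (Ioo_subset_Icc_self hs)).2)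
    (fun s hs h0 => hβ.deriv_deriv_sub_le hN hf hreg hhor (hsub s (Ioo_subset_Icc_self hs))
      (hy s (Ioo_subset_Icc_self hs)) h0) ht

end VerticalGeodesics

/-! ### Passage to the ambient spaces and to extended-valued costs. -/

lemma coe_realCost {M M' X X' : Type*} {ι : M → X} {κ : M' → X'} {c : X × X' → WithTop ℝ}
    {N : Set (M × M')} (hfin : ∀ p ∈ N, c (ι p.1, κ p.2) ≠ ⊤) {p : M × M'} (hp : p ∈ N) :
    c (ι p.1, κ p.2) = (realCost ι κ c p : ℝ) := by
  obtain ⟨r, hr⟩ := WithTop.ne_top_iff_exists.1 (hfin p hp)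
  simp [realCost, ← hr]

section Ambient

variable {n : ℕ} {M M' X X' : Type*}
  [TopologicalSpace M] [ChartedSpace (EuclideanSpace ℝ (Fin n)) M]
  [TopologicalSpace M'] [ChartedSpace (EuclideanSpace ℝ (Fin n)) M']
  [TopologicalSpace X] [TopologicalSpace X']
  {ι : M → X} {κ : M' → X'} {c : X × X' → WithTop ℝ} {N : Set (M × M')}

lemma GeodesicEqAt.congr {f : M × M' → ℝ} {σ σ' : ℝ → M × M'} {t : ℝ}
    (h : GeodesicEqAt n f σ t) (he : σ =ᶠ[𝓝 t] σ') : GeodesicEqAt n f σ' t := by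
  have h0 : σ t = σ' t := he.eq_of_nhds
  have hc : ∀ A : Idx n, (fun r => coordFun A (toCoord (n := n) (σ t) (σ r)))
      =ᶠ[𝓝 t] fun r => coordFun A (toCoord (σ' t) (σ' r)) := by
    intro A
    filter_upwards [he] with r hr
    rw [h0, hr]
  intro A
  have h1 := h A
  simp only [(hc _).deriv_eq] at h1
  rw [(hc A).deriv.deriv_eq] at h1
  rwa [h0] at h1

lemma deriv_comp_affine {E : Type*} [NormedAddCommGroup E] [NormedSpace ℝ E] (F : ℝ → E)
    (a k t : ℝ) : deriv (fun r => F (a + k * r)) t = k • deriv F (a + k * t) := by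
  rw [deriv_comp_mul_left k (fun u => F (a + u)) t, deriv_comp_const_add]

/-- Both terms of the equation scale by `k ^ 2`. The value `k = 0` is allowed and gives constant
curves. -/
lemma GeodesicEqAt.comp_affine {f : M × M' → ℝ} {σ : ℝ → M × M'} {a k t : ℝ}
    (h : GeodesicEqAt n f σ (a + k * t)) : GeodesicEqAt n f (fun r => σ (a + k * r)) t := by
  intro A
  have hd : ∀ I : Idx n, deriv (fun r => coordFun I (toCoord (n := n) (σ (a + k * t))
      (σ (a + k * r)))) = fun r => k * deriv (fun r => coordFun I (toCoord (n := n)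
        (σ (a + k * t)) (σ r))) (a + k * r) := by
    intro I
    ext r
    exact deriv_comp_affine (fun r => coordFun I (toCoord (n := n) (σ (a + k * t)) (σ r))) a k r
  have hdd : deriv (deriv fun r => coordFun A (toCoord (n := n) (σ (a + k * t))
      (σ (a + k * r)))) t = k ^ 2 * deriv (deriv fun r => coordFun A (toCoord (n := n)
        (σ (a + k * t)) (σ r))) (a + k * t) := by
    rw [hd A, deriv_const_mul_field, deriv_comp_affine]
    simp only [smul_eq_mul]
    ring
  rw [hdd]
  simp only [hd]
  rw [← mul_zero (k ^ 2), ← h A, mul_add, Finset.mul_sum]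
  congr 1
  refine Finset.sum_congr rfl fun I _ => ?_
  rw [Finset.mul_sum]
  exact Finset.sum_congr rfl fun J _ => by ring

lemma HorizontallyConvex.exists_horizontalGeodesic (hhc : HorizontallyConvex n ι κ c N)
    (hι : IsEmbedding ι) (hκ : IsEmbedding κ) (b : M') (y₀ y₁ : M) (h₀ : (y₀, b) ∈ N)
    (h₁ : (y₁, b) ∈ N) (hne : y₀ ≠ y₁) :
    ∃ Y, HorizontalGeodesic n (realCost ι κ c) N b Y ∧ Y 0 = y₀ ∧ Y 1 = y₁ := by
  obtain ⟨γ, ⟨hγc, σ, hσ, hγσ⟩, hγ0, hγ1, hmem⟩ := (hhc b).1.2 (ι y₀, κ b)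
    ⟨⟨y₀, h₀, rfl⟩, rfl⟩ (ι y₁, κ b) ⟨⟨y₁, h₁, rfl⟩, rfl⟩
    (fun h => hne (hι.injective (congrArg Prod.fst h)))
  have : Nonempty M := ⟨y₀⟩
  -- The segment stays in the visible set itself and not just in its closure, so its endpoints also
  -- lie in `N`.
  have hex : ∀ t ∈ Icc (0 : ℝ) 1, ∃ m, (m, b) ∈ N ∧ γ t = (ι m, κ b) := by
    intro t ht
    obtain ⟨⟨m, hm, hm'⟩, hκb⟩ := hmem t ht
    exact ⟨m, hm, Prod.ext hm'.symm hκb⟩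
  choose! Y hY using hex
  have hYσ : ∀ t ∈ Ioo (0 : ℝ) 1, σ t = (Y t, b) := by
    intro t ht
    have h := (hγσ t ht).symm.trans (hY t (Ioo_subset_Icc_self ht)).2
    exact Prod.ext (hι.injective (congrArg Prod.fst h)) (hκ.injective (congrArg Prod.snd h))
  have hev : ∀ t ∈ Ioo (0 : ℝ) 1, σ =ᶠ[𝓝 t] fun r => (Y r, b) := fun t ht =>
    Filter.eventually_of_mem (Ioo_mem_nhds ht.1 ht.2) hYσ
  refine ⟨Y, ⟨fun s hs => (hY s hs).1, ?_, fun s hs => ?_, fun s hs => ?_⟩, ?_, ?_⟩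
  · rw [hι.isInducing.continuousOn_iff]
    exact (continuous_fst.comp_continuousOn hγc).congr fun t ht => by
      simp [(hY t ht).2]
  · exact ((hσ.1.contMDiffAt (Ioo_mem_nhds hs.1 hs.2)).congr_of_eventuallyEq
      (hev s hs).symm).fst
  · exact (hσ.2 s hs).2.congr (hev s hs)
  · exact hι.injective (congrArg Prod.fst ((hY 0 (by simp)).2.symm.trans hγ0))
  · exact hι.injective (congrArg Prod.fst ((hY 1 (by simp)).2.symm.trans hγ1))

variable {x : M} {β : ℝ → M'}

/-- A closed piece of a vertical geodesic, parametrized by `[0,1]`. -/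
lemma VerticalGeodesic.isGeodesicSegment (hβ : VerticalGeodesic n (realCost ι κ c) N x β)
    (hκ : IsEmbedding κ) {a d : ℝ} (ha : 0 < a) (had : a ≤ d) (hd : d < 1) :
    IsGeodesicSegment n ι κ c N (fun t => (ι x, κ (β (a + (d - a) * t)))) := by
  have hmaps : ∀ t ∈ Icc (0 : ℝ) 1, a + (d - a) * t ∈ Ioo (0 : ℝ) 1 := by
    intro t ht
    constructor <;> nlinarith [ht.1, ht.2, mul_nonneg (sub_nonneg.2 had) ht.1,
      mul_nonneg (sub_nonneg.2 had) (sub_nonneg.2 ht.2)]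
  have haff : ContMDiff 𝓘(ℝ, ℝ) 𝓘(ℝ, ℝ) 2 (fun t : ℝ => a + (d - a) * t) :=
    ContDiff.contMDiff (by fun_prop)
  have hsm : ∀ t ∈ Icc (0 : ℝ) 1,
      ContMDiffAt 𝓘(ℝ, ℝ) (𝓡 n) 2 (fun t => β (a + (d - a) * t)) t := fun t ht =>
    (hβ.contMDiffAt _ (hmaps t ht)).comp t haff.contMDiffAt
  refine ⟨fun t ht => ?_, fun t => (x, β (a + (d - a) * t)), ⟨fun t ht => ?_, fun t ht => ?_⟩,
    fun t _ => rfl⟩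
  · exact (continuousAt_const.prodMk
      (hκ.continuous.continuousAt.comp (hsm t ht).continuousAt)).continuousWithinAt
  · exact (contMDiffAt_const.prodMk (hsm t (Ioo_subset_Icc_self ht))).contMDiffWithinAt
  · have ht' := hmaps t (Ioo_subset_Icc_self ht)
    exact ⟨hβ.mem _ ht', (hβ.geodesicEqAt _ ht').comp_affine⟩

lemma isPreconnected_of_appearsConvex {S : Set X'} (h : AppearsConvex n ι κ c N x S) :
    IsPreconnected S := by
  refine isPreconnected_of_forall_pair fun a ha b hb => ?_
  by_cases hab : a = b
  · subst hab
    exact ⟨{a}, by simpa using ha, rfl, rfl, isPreconnected_singleton⟩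
  obtain ⟨γ, ⟨hγc, -⟩, h0, h1, hmem⟩ := h.1.2 (ι x, a) ⟨rfl, ha⟩ (ι x, b) ⟨rfl, hb⟩
    (fun h => hab (congrArg Prod.snd h))
  refine ⟨(fun t => (γ t).2) '' Icc (0 : ℝ) 1, ?_, ⟨0, by simp, by simp [h0]⟩,
    ⟨1, by simp, by simp [h1]⟩,
    isPreconnected_Icc.image _ (continuous_snd.comp_continuousOn hγc)⟩
  rintro _ ⟨t, ht, rfl⟩
  exact (hmem t ht).2

variable [IsManifold (𝓡 n) ∞ M] [IsManifold (𝓡 n) ∞ M']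

/-- The contact inequality propagates along a vertical geodesic `β` with endpoints `b₀`, `b₁`. -/
lemma VerticalGeodesic.contact_inequality (hβ : VerticalGeodesic n (realCost ι κ c) N x β)
    (hι : IsEmbedding ι) (hN : IsOpen N) (hc4 : IsC4On n ι κ c N)
    (hreg : WeaklyRegular n (realCost ι κ c) N)
    (hhor : ∀ b y₀ y₁, (y₀, b) ∈ N → (y₁, b) ∈ N → y₀ ≠ y₁ →
      ∃ Y, HorizontalGeodesic n (realCost ι κ c) N b Y ∧ Y 0 = y₀ ∧ Y 1 = y₁)
    (hcont : ContinuousOn c (closure (embed ι κ N))) {y : X}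
    (hdense : ∀ a d, 0 < a → a ≤ d → d < 1 →
      y ∈ closure (⋂ t ∈ Icc (0 : ℝ) 1, visibleFrom' ι N (β (a + (d - a) * t))))
    {δ : ℝ → X'} (hδ : ContinuousOn δ (Icc 0 1)) (hδβ : ∀ t ∈ Ioo (0 : ℝ) 1, δ t = κ (β t))
    {U V : ℝ} (hfin₀ : c (ι x, δ 0) < ⊤) (hfin₁ : c (ι x, δ 1) < ⊤)
    (h₀ : (U : WithTop ℝ) + c (ι x, δ 0) ≤ V + c (y, δ 0))
    (h₁ : (U : WithTop ℝ) + c (ι x, δ 1) ≤ V + c (y, δ 1)) {t : ℝ} (ht : t ∈ Ioo (0 : ℝ) 1) :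
    (U : WithTop ℝ) + c (ι x, κ (β t)) ≤ V + c (y, κ (β t)) := by
  by_contra! hlt
  have hxcl : ∀ s ∈ Icc (0 : ℝ) 1, (ι x, δ s) ∈ closure (embed ι κ N) := by
    have : ∀ s ∈ Ioo (0 : ℝ) 1, (ι x, δ s) ∈ embed ι κ N := fun s hs =>
      ⟨(x, β s), hβ.mem s hs, by rw [hδβ s hs]; rfl⟩
    intro s hs
    refine ((continuousOn_const.prodMk hδ) s hs |>.mono Ioo_subset_Icc_self).mem_closure ?_ this
    rwa [closure_Ioo (by norm_num)]
  have hyvis : ∀ a d, 0 < a → a ≤ d → d < 1 → ∀ s ∈ Icc a d,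
      (⋂ t ∈ Icc (0 : ℝ) 1, visibleFrom' ι N (β (a + (d - a) * t)))
        ⊆ visibleFrom' ι N (β s) := by
    intro a d _ had _ s hs
    -- The degenerate piece `a = d` is needed below: it places `y` in the closure of the set visible
    -- from a single point `β s`.
    rcases had.eq_or_lt with rfl | had'
    · obtain rfl : s = a := le_antisymm hs.2 hs.1
      refine (biInter_subset_of_mem (x := (0 : ℝ)) (by simp)).trans ?_
      simp
    · have hpos : 0 < d - a := sub_pos.2 had'
      have hτ : (s - a) / (d - a) ∈ Icc (0 : ℝ) 1 :=
        ⟨div_nonneg (sub_nonneg.2 hs.1) hpos.le, (div_le_one hpos).2 (by linarith [hs.2])⟩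
      refine (biInter_subset_of_mem hτ).trans ?_
      rw [mul_div_cancel₀ _ hpos.ne', add_sub_cancel]
  have hyembed : ∀ s, ∀ m ∈ visibleFrom' ι N (β s), (m, κ (β s)) ∈ embed ι κ N := by
    rintro s _ ⟨m, hm, rfl⟩
    exact ⟨(m, β s), hm, rfl⟩
  have hycl : ∀ s ∈ Icc (0 : ℝ) 1, (y, δ s) ∈ closure (embed ι κ N) := by
    have : ∀ s ∈ Ioo (0 : ℝ) 1, (y, δ s) ∈ closure (embed ι κ N) := by
      intro s hs
      rw [hδβ s hs]
      have hy := hdense s s hs.1 le_rfl hs.2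
      refine ContinuousWithinAt.mem_closure (f := fun m => (m, κ (β s)))
        (by fun_prop : Continuous fun m : X => (m, κ (β s))).continuousWithinAt hy ?_
      exact fun m hm => hyembed s m (hyvis s s hs.1 le_rfl hs.2 s ⟨le_rfl, le_rfl⟩ hm)
    intro s hs
    have h := ((continuousOn_const (c := y)).prodMk hδ s hs |>.mono Ioo_subset_Icc_self).mem_closure
      (by rwa [closure_Ioo (by norm_num)]) this
    rwa [closure_closure] at h
  have hcx : ContinuousOn (fun s => c (ι x, δ s)) (Icc 0 1) :=
    hcont.comp (continuousOn_const.prodMk hδ) hxcl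
  have hcy : ContinuousOn (fun s => c (y, δ s)) (Icc 0 1) :=
    hcont.comp (continuousOn_const.prodMk hδ) hycl
  have hfinite : ∀ p ∈ N, c (ι p.1, κ p.2) = (realCost ι κ c p : ℝ) := fun p hp =>
    coe_realCost hc4.1 hp
  set A := realCost ι κ c (x, β t) with hA
  rw [hfinite (x, β t) (hβ.mem t ht)] at hlt
  have hytop : c (y, κ (β t)) ≠ ⊤ := by
    intro h
    rw [h, WithTop.add_top] at hlt
    exact not_top_lt hlt
  obtain ⟨B, hB⟩ := WithTop.ne_top_iff_exists.1 hytop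
  rw [← hB] at hlt
  have hAB : V + B < U + A := by exact_mod_cast hlt
  -- One third of the violation at time `t`: near an endpoint both costs are controlled up to `ε`,
  -- and at time `t` replacing `y` by a nearby point costs a third `ε`.
  set ε := (U + A - V - B) / 3 with hε
  have hε0 : 0 < ε := by rw [hε]; linarith
  -- An endpoint may lie on the boundary, and the cost from `y` may be infinite there. The contact
  -- inequality is therefore kept as two strict bounds around the finite value `q` at `x`, which
  -- persist at nearby interior times.
  have hend : ∀ e ∈ Icc (0 : ℝ) 1, c (ι x, δ e) < ⊤ →
      (U : WithTop ℝ) + c (ι x, δ e) ≤ V + c (y, δ e) →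
      ∃ q : ℝ, ∀ᶠ s in 𝓝[Icc 0 1] e, c (ι x, δ s) < ((q + ε : ℝ) : WithTop ℝ) ∧
        ((U - V + q - ε : ℝ) : WithTop ℝ) < c (y, δ s) := by
    intro e he hfin hle
    obtain ⟨q, hq⟩ := WithTop.ne_top_iff_exists.1 hfin.ne
    refine ⟨q, ((hcx e he).eventually (gt_mem_nhds ?_)).and
      ((hcy e he).eventually (lt_mem_nhds ?_))⟩
    · beta_reduce
      rw [← hq]
      exact_mod_cast (by linarith : q < q + ε)
    · beta_reduce
      rw [← hq] at hle
      rcases eq_or_ne (c (y, δ e)) ⊤ with htop | hne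
      · rw [htop]
        exact WithTop.coe_lt_top _
      · obtain ⟨r, hr⟩ := WithTop.ne_top_iff_exists.1 hne
        rw [← hr] at hle ⊢
        have hle' : U + q ≤ V + r := by exact_mod_cast hle
        exact_mod_cast (by linarith : U - V + q - ε < r)
  obtain ⟨q₀, hq₀⟩ := hend 0 (by simp) hfin₀ h₀
  obtain ⟨q₁, hq₁⟩ := hend 1 (by simp) hfin₁ h₁
  have hl : ∀ᶠ s in 𝓝[>] (0 : ℝ), s ∈ Ioo 0 t ∧ c (ι x, δ s) < ((q₀ + ε : ℝ) : WithTop ℝ) ∧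
      ((U - V + q₀ - ε : ℝ) : WithTop ℝ) < c (y, δ s) :=
    (Filter.eventually_of_mem (Ioo_mem_nhdsGT ht.1) fun s hs => hs).and
      (hq₀.filter_mono (nhdsWithin_le_of_mem (Icc_mem_nhdsGT zero_lt_one)))
  have hr : ∀ᶠ s in 𝓝[<] (1 : ℝ), s ∈ Ioo t 1 ∧ c (ι x, δ s) < ((q₁ + ε : ℝ) : WithTop ℝ) ∧
      ((U - V + q₁ - ε : ℝ) : WithTop ℝ) < c (y, δ s) :=
    (Filter.eventually_of_mem (Ioo_mem_nhdsLT ht.2) fun s hs => hs).and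
      (hq₁.filter_mono (nhdsWithin_le_of_mem (Icc_mem_nhdsLT zero_lt_one)))
  obtain ⟨a, haI, hax, hay⟩ := hl.exists
  obtain ⟨d, hdI, hdx, hdy⟩ := hr.exists
  have haI' : a ∈ Ioo (0 : ℝ) 1 := ⟨haI.1, haI.2.trans ht.2⟩
  have hdI' : d ∈ Ioo (0 : ℝ) 1 := ⟨ht.1.trans hdI.1, hdI.2⟩
  have had : a ≤ d := (haI.2.trans hdI.1).le
  rw [hδβ a haI'] at hax hay
  rw [hδβ d hdI'] at hdx hdy
  have hyD := hdense a d haI.1 had hdI.2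
  set D := ⋂ t ∈ Icc (0 : ℝ) 1, visibleFrom' ι N (β (a + (d - a) * t)) with hD
  have hDvis := hyvis a d haI.1 had hdI.2
  have hDc : ∀ s ∈ Icc a d, ContinuousWithinAt (fun m => c (m, κ (β s))) D y := by
    intro s hs
    have hsI : s ∈ Ioo (0 : ℝ) 1 := ⟨haI.1.trans_le hs.1, hs.2.trans_lt hdI.2⟩
    refine ContinuousWithinAt.comp (t := closure (embed ι κ N)) (g := c)
      (f := fun m => (m, κ (β s))) ?_
      (by fun_prop : Continuous fun m : X => (m, κ (β s))).continuousWithinAt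
      fun m hm => subset_closure (hyembed s m (hDvis s hs hm))
    have := hcont _ (hycl s (Ioo_subset_Icc_self hsI))
    rwa [hδβ s hsI] at this
  have hta : t ∈ Icc a d := ⟨haI.2.le, hdI.1.le⟩
  have haa : a ∈ Icc a d := ⟨le_rfl, had⟩
  have hdd : d ∈ Icc a d := ⟨had, le_rfl⟩
  have hBt : c (y, κ (β t)) < ((B + ε : ℝ) : WithTop ℝ) := by
    rw [← hB]
    exact_mod_cast (by linarith : B < B + ε)
  have : (𝓝[D] y).NeBot := mem_closure_iff_nhdsWithin_neBot.1 hyD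
  -- The three bounds are open conditions, so they survive replacing `y` by a nearby point of `D`,
  -- which is visible from the whole piece of `β` on `[a, d]`. The maximum principle applies to that
  -- point.
  obtain ⟨m, ⟨⟨hma, hmd⟩, hmt⟩, hmD⟩ := (((((hDc a haa).eventually (lt_mem_nhds hay)).and
    ((hDc d hdd).eventually (lt_mem_nhds hdy))).and
    ((hDc t hta).eventually (gt_mem_nhds hBt))).and self_mem_nhdsWithin).exists
  obtain ⟨y', -, rfl⟩ := hDvis a haa hmD
  have hy'N : ∀ s ∈ Icc a d, (y', β s) ∈ N := by
    intro s hs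
    obtain ⟨m, hm, hme⟩ := hDvis s hs hmD
    rwa [hι.injective hme] at hm
  have hmin := hβ.min_le hN hc4.2 hreg hhor haI.1 hdI.2 hy'N hta
  rw [hfinite (y', β a) (hy'N a haa)] at hma
  rw [hfinite (y', β d) (hy'N d hdd)] at hmd
  rw [hfinite (y', β t) (hy'N t hta)] at hmt
  rw [hfinite (x, β a) (hβ.mem a haI')] at hax
  rw [hfinite (x, β d) (hβ.mem d hdI')] at hdx
  have g1 := WithTop.coe_lt_coe.1 hma
  have g2 := WithTop.coe_lt_coe.1 hmd
  have g3 := WithTop.coe_lt_coe.1 hmt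
  have g4 := WithTop.coe_lt_coe.1 hax
  have g5 := WithTop.coe_lt_coe.1 hdx
  rcases min_le_iff.1 hmin with h | h <;> linarith

end Ambient

end CostGeometry

end

/-! ### The contact set appears convex. -/

theorem theorem3p1 {n : ℕ} {M M' X X' : Type*}
    [TopologicalSpace M] [ChartedSpace (EuclideanSpace ℝ (Fin n)) M]
    [IsManifold (𝓡 n) ∞ M]
    [TopologicalSpace M'] [ChartedSpace (EuclideanSpace ℝ (Fin n)) M']
    [IsManifold (𝓡 n) ∞ M']
    [TopologicalSpace X] [TopologicalSpace.MetrizableSpace X]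
    [TopologicalSpace.SeparableSpace X]
    [TopologicalSpace X'] [TopologicalSpace.MetrizableSpace X']
    [TopologicalSpace.SeparableSpace X']
    -- the manifolds are embedded in spaces where their closures are compact
    (ι : M → X) (hι : IsEmbedding ι) (hMc : IsCompact (closure (range ι)))
    (κ : M' → X') (hκ : IsEmbedding κ) (hMc' : IsCompact (closure (range κ)))
    -- the cost and the domain
    (c : X × X' → WithTop ℝ) (N : Set (M × M')) (hN : IsOpen N)
    (hc4 : CostGeometry.IsC4On n ι κ c N)
    (hnd : CostGeometry.Nondegenerate n (CostGeometry.realCost ι κ c) N)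
    (hhc : CostGeometry.HorizontallyConvex n ι κ c N)
    -- the sets `Ω`, `Ω̄` and the point `x`
    (Ω : Set X) (hΩ : Ω ⊆ closure (range ι)) (x : M)
    (Ω' : Set X') (hΩ' : Ω' ⊆ closure (CostGeometry.visibleFrom κ N x))
    (hconv : CostGeometry.AppearsConvex n ι κ c N x Ω')
    -- density of the points visible from all points of a geodesic
    (hdense : ∀ b : ℝ → M',
      CostGeometry.IsGeodesicSegment n ι κ c N (fun t => (ι x, κ (b t))) →
      (∀ t ∈ Icc (0 : ℝ) 1, (x, b t) ∈ N ∧ κ (b t) ∈ Ω') →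
      Ω ⊆ closure (⋂ t ∈ Icc (0 : ℝ) 1, CostGeometry.visibleFrom' ι N (b t)))
    (hcont : ContinuousOn c (closure (CostGeometry.embed ι κ N)))
    (hreg : CostGeometry.WeaklyRegular n (CostGeometry.realCost ι κ c) N)
    (u : X → WithTop ℝ) (hxΩ : ι x ∈ Ω) (hux : u (ι x) < ⊤) :
    IsPreconnected (Ω' ∩ CostGeometry.cContactSet ι κ c Ω u (ι x)) ∧
      CostGeometry.AppearsConvex n ι κ c N x
        (Ω' ∩ CostGeometry.cContactSet ι κ c Ω u (ι x)) := by
  open CostGeometry in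
  have key : AppearsConvex n ι κ c N x (Ω' ∩ cContactSet ι κ c Ω u (ι x)) := by
    refine ⟨⟨(prod_mono_right inter_subset_left).trans hconv.1.1, ?_⟩,
      inter_subset_left.trans hΩ'⟩
    rintro ⟨-, b₀⟩ ⟨rfl, hb₀, hk₀⟩ ⟨a₁, b₁⟩ ⟨ha₁, hb₁, hk₁⟩ hne
    obtain rfl : a₁ = ι x := ha₁
    obtain ⟨γ, hseg, h0, h1, hmem⟩ := hconv.1.2 (ι x, b₀) ⟨rfl, hb₀⟩ (ι x, b₁) ⟨rfl, hb₁⟩ hne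
    refine ⟨γ, hseg, h0, h1, fun t ht => ⟨(hmem t ht).1, (hmem t ht).2, ?_⟩⟩
    obtain ⟨hγc, σ, hσ, hγσ⟩ := hseg
    -- Only the values of `β` on `]0,1[` matter; the endpoints are read off from `γ`, as they may
    -- lie outside the manifold.
    set β : ℝ → M' := fun r => (σ r).2 with hβdef
    have hσβ : ∀ s ∈ Ioo (0 : ℝ) 1, σ s = (x, β s) := fun s hs =>
      Prod.ext (hι.injective ((congrArg Prod.fst (hγσ s hs)).symm.trans
        (hmem s (Ioo_subset_Icc_self hs)).1)) rfl
    have hγβ : ∀ s ∈ Ioo (0 : ℝ) 1, γ s = (ι x, κ (β s)) := fun s hs => by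
      rw [hγσ s hs, hσβ s hs]
      rfl
    have hβ : VerticalGeodesic n (realCost ι κ c) N x β :=
      ⟨fun s hs => hσβ s hs ▸ (hσ.2 s hs).1,
        fun s hs => (hσ.1.contMDiffAt (Ioo_mem_nhds hs.1 hs.2)).snd,
        fun s hs => (hσ.2 s hs).2.congr
          (Filter.eventually_of_mem (Ioo_mem_nhds hs.1 hs.2) hσβ)⟩
    rcases ht.1.eq_or_lt with rfl | ht0
    · rwa [h0]
    rcases ht.2.eq_or_lt with rfl | ht1
    · rwa [h1]
    have htI : t ∈ Ioo (0 : ℝ) 1 := ⟨ht0, ht1⟩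
    have hsnd : (γ t).2 = κ (β t) := by rw [hγβ t htI]
    rw [hsnd]
    refine ⟨subset_closure ⟨_, rfl⟩, hxΩ, ⟨subset_closure ⟨⟨x, rfl⟩, ⟨_, rfl⟩⟩,
      lt_top_iff_ne_top.2 (hc4.1 _ (hβ.mem t htI))⟩, fun y hy => ?_⟩
    obtain ⟨U, hU⟩ := WithTop.ne_top_iff_exists.1 hux.ne
    rcases eq_or_ne (u y) ⊤ with htop | hne_top
    · simp only [htop, WithTop.top_add]
      exact le_top
    obtain ⟨V, hV⟩ := WithTop.ne_top_iff_exists.1 hne_top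
    have hin₀ := hk₀.2.2.2 y hy
    have hin₁ := hk₁.2.2.2 y hy
    have hf₀ := hk₀.2.2.1.2
    have hf₁ := hk₁.2.2.1.2
    simp only [← hU, ← hV] at hin₀ hin₁ ⊢
    have e0 : (γ 0).2 = b₀ := by rw [h0]
    have e1 : (γ 1).2 = b₁ := by rw [h1]
    refine hβ.contact_inequality hι hN hc4 hreg (hhc.exists_horizontalGeodesic hι hκ) hcont
      (y := y) (δ := fun s => (γ s).2) ?_ (continuous_snd.comp_continuousOn hγc)
      (fun s hs => by rw [hγβ s hs]) (by simpa only [e0] using hf₀) (by simpa only [e1] using hf₁)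
      (by simpa only [e0] using hin₀) (by simpa only [e1] using hin₁) htI
    -- The density hypothesis concerns geodesics lying in `N` up to their endpoints, so it is
    -- applied to the piece of `β` on `[a, d]`, rescaled to `[0,1]`.
    intro a d ha had hd
    have hmaps : ∀ r ∈ Icc (0 : ℝ) 1, a + (d - a) * r ∈ Ioo (0 : ℝ) 1 := by
      intro r hr
      constructor <;> nlinarith [mul_nonneg (sub_nonneg.2 had) hr.1,
        mul_nonneg (sub_nonneg.2 had) (sub_nonneg.2 hr.2)]
    refine hdense (fun r => β (a + (d - a) * r)) (hβ.isGeodesicSegment hκ ha had hd)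
      (fun r hr => ⟨hβ.mem _ (hmaps r hr), ?_⟩) hy
    have h := (hmem _ (Ioo_subset_Icc_self (hmaps r hr))).2
    rwa [hγβ _ (hmaps r hr)] at h
  exact ⟨CostGeometry.isPreconnected_of_appearsConvex key, key⟩
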